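/- **Setting.** Let $(X,d)$ be a Polish space and $d_L:X\times X\to[0,+\infty]$ a Borel distance (possibly infinite) such that $(X,d_L)$ is a non-branching geodesic space: points at finite $d_L$-distance are joined by a geodesic, and $d_L(x,y)=d_L(y,z)=d_L(y,z')=r/2$, $d_L(x,z)=d_L(x,z')=r$ imply $z=z'$. A geodesic is a map $\gamma:I\to X$ on an interval $I\subset\mathbb R$ (not necessarily closed or bounded) with $d_L(\gamma(s),\gamma(t))=|s-t|$. Geodesics are assumed $d$-continuous and locally compact in $(X,d)$: for each $s\in I$ there is $r>0$ such that $\gamma^{-1}(\bar B_r(\gamma(s)))$ is compact in $\mathbb R$, where $\bar B_r$ is the closed $d$-ball. Let $\mu,\nu$ be Borel probability measures on $X$ and let $\pi$ be a transference plan from $\mu$ to $\nu$ with $\int d_L\,d\pi<\infty$, concentrated on a $d_L$-cyclically monotone set $\Gamma\subset\{d_L<\infty\}$, $\Gamma=\bigcup_n\Gamma_n$ with $\Gamma_n\subset\Gamma_{n+1}$ compact and $d_L|_{\Gamma_n}$ continuous. Let - $\Gamma'$ be the set of pairs $(w_0,z_I)$ for which there are $I\ge 0$ and $(w_0,z_0),\dots,(w_I,z_I)\in\Gamma$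 with $\sum_{i=0}^I \big(d_L(w_{i+1},z_i)-d_L(w_i,z_i)\big)=0$, $w_{I+1}:=w_0$; - $G=\{(x,y):\exists (w,z)\in\Gamma',\ d_L(w,x)+d_L(x,y)+d_L(y,z)=d_L(w,z)\}$, $R=G\cup G^{-1}$, and $R(x)=\{y:(x,y)\in R\}$ be the ray of $x$; - $\mathcal T$ (resp. $\mathcal T_e$) be the set of $x$ such that $(w,x)\in G$ for some $w\ne x$ and (resp. or) $(x,z)\in G$ for some $z\neq x$; these are the transport sets without and with endpoints. A $\mu$-measurable cross section is a $\mu$-measurable map $f:\mathcal T\to\mathcal T$ with $f(x)\in R(x)$ that is constant on the classes of $R$ on $\mathcal T$. Given $f$, put $m=f_\sharp(\mu\llcorner_{\mathcal T})$. For $y\in f(\mathcal T)$ and $t\in\mathbb R$ let $g(y,t)$ be the point $x$ with $d_L(x,y)=|t|$ and $(y,x)\in G$ if $t\ge0$, $(x,y)\in G$ if $t<0$, when it exists. For $A\subset X$ let $A_t=g(g^{-1}(A)+(0,t))$. **Theorem.** There exists a $\mu$-measurable cross section $f$. For every such $f$, assume the absolute continuity condition: for every Borel set $A\subset\mathcal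 T_e$, $$\mu(A)>0\ \Longrightarrow\ \int_0^{+\infty}\mu(A_t)\,dt>0 .$$ Then: 1. $\mu(\mathcal T_e\setminus\mathcal T)=0$; if moreover the condition holds for every Borel $A\subset X$, then $\mu(X\setminus\mathcal T)=0$, i.e. $\mu$ is concentrated on $\mathcal T$. 2. $\mu\llcorner_{\mathcal T}$ has a disintegration $\mu\llcorner_{\mathcal T}=\int\mu_y\,m(dy)$ strongly consistent with $f$: for every Borel $B$ the function $y\mapsto\mu_y(B)$ is $m$-measurable, $\mu(\mathcal T\cap B\cap f^{-1}(C))=\int_C\mu_y(B)\,m(dy)$ for all Borel $B,C$, and for every $y\in f(\mathcal T)$, $\mu_y$ is a Borel probability measure concentrated on $f^{-1}(y)$. 3. For every such disintegration and for $m$-a.e. $y$, the conditional probability $\mu_y$ is absolutely continuous with respect to the one-dimensional Hausdorff measure $\mathcal H^1_{d_L}$ (induced by $d_L$) restricted to the ray $R(y)$, and with respect to $g(y,\cdot)_\sharp\mathcal L^1$. -/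

import Mathlib

open MeasureTheory Set
open scoped ENNReal

namespace MongeRays

/-- A distance on `X` with values in `[0,+∞]`. -/
structure ExtDist (X : Type*) where
  dist : X → X → ℝ≥0∞
  dist_self : ∀ x, dist x x = 0
  eq_of_dist_eq_zero : ∀ x y, dist x y = 0 → x = y
  symm : ∀ x y, dist x y = dist y x
  triangle : ∀ x y z, dist x z ≤ dist x y + dist y z

section Metric

variable {X : Type*}

/-- The extended metric structure induced by the distance `d_L`. It is never used as a global
instance: the topology and the Borel sets of `X` are always those of the Polish distance `d`. -/
@[reducible] noncomputable def ExtDist.toEMetricSpace (dL : ExtDist X) : EMetricSpace X where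
  edist := dL.dist
  edist_self := dL.dist_self
  edist_comm := dL.symm
  edist_triangle := dL.triangle
  eq_of_edist_eq_zero := fun {x y} h => dL.eq_of_dist_eq_zero x y h

/-- The one-dimensional Hausdorff (outer) measure on subsets of `X` induced by `d_L`. -/
noncomputable def hausdorffOne (dL : ExtDist X) : OuterMeasure X :=
  letI : EMetricSpace X := dL.toEMetricSpace
  OuterMeasure.mkMetric fun r => r

/-- A geodesic of `(X, d_L)`, parametrized by arc length on an interval `I` of the line (open,
closed, half-open, bounded or unbounded): the length of the curve between any two of its points
is their distance. -/
def IsGeodesic (dL : ExtDist X) (I : Set ℝ) (γ : ℝ → X) : Prop :=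
  I.OrdConnected ∧ ∀ s ∈ I, ∀ t ∈ I, dL.dist (γ s) (γ t) = ENNReal.ofReal |s - t|

/-- Strict convexity of `d_L`, i.e. geodesics do not branch: if `y` is the midpoint of `x, z`
and also of `x, z'`, then `z = z'`. -/
def NonBranching (dL : ExtDist X) : Prop :=
  ∀ (r : ℝ) (x y z z' : X), 0 ≤ r → dL.dist x y = ENNReal.ofReal (r / 2) →
    dL.dist x z = ENNReal.ofReal r → dL.dist y z = ENNReal.ofReal (r / 2) →
    dL.dist x z' = ENNReal.ofReal r → dL.dist y z' = ENNReal.ofReal (r / 2) → z = z'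

/-- The metric setting: `d` is the distance of the metric space `X`, and `d_L` is a Borel distance
such that `(X, d_L)` is a non-branching geodesic space whose geodesics are continuous and locally
compact with respect to `d`. -/
structure IsGeodesicSetting [MetricSpace X] [MeasurableSpace X] (dL : ExtDist X) : Prop where
  borel : Measurable fun p : X × X => dL.dist p.1 p.2
  geodesic : ∀ x y, dL.dist x y ≠ ∞ → ∃ γ : ℝ → X,
    IsGeodesic dL (Icc 0 (dL.dist x y).toReal) γ ∧ γ 0 = x ∧ γ (dL.dist x y).toReal = y
  nonBranching : NonBranching dL
  continuous : ∀ (I : Set ℝ) (γ : ℝ → X), IsGeodesic dL I γ → ContinuousOn γ I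
  locallyCompact : ∀ (I : Set ℝ) (γ : ℝ → X), IsGeodesic dL I γ →
    ∀ s ∈ I, ∃ r > 0, IsCompact (I ∩ γ ⁻¹' Metric.closedBall (γ s) r)

/-- `d_L`-cyclical monotonicity; the indices live in `Fin (n + 1)`, so that `i + 1` is the
cyclic successor. -/
def CyclicallyMonotone (dL : ExtDist X) (Γ : Set (X × X)) : Prop :=
  ∀ (n : ℕ) (p : Fin (n + 1) → X × X), (∀ i, p i ∈ Γ) →
    ∑ i, dL.dist (p i).1 (p i).2 ≤ ∑ i, dL.dist (p (i + 1)).1 (p i).2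

/-- `π` is a transference plan from `μ` to `ν` with finite cost, concentrated on the
`d_L`-cyclically monotone set `Γ ⊆ {d_L < ∞}`, which is a countable increasing union of compact
sets on each of which `d_L` is continuous. -/
structure IsMonotonePlan [MetricSpace X] [MeasurableSpace X] (dL : ExtDist X)
    (μ ν : Measure X) (π : Measure (X × X)) (Γ : Set (X × X)) : Prop where
  fst : π.map Prod.fst = μ
  snd : π.map Prod.snd = ν
  finite_cost : ∫⁻ p, dL.dist p.1 p.2 ∂π < ∞
  monotone : CyclicallyMonotone dL Γ
  concentrated : π Γᶜ = 0
  finite_on : ∀ p ∈ Γ, dL.dist p.1 p.2 < ∞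
  sigmaCompact : ∃ K : ℕ → Set (X × X), Monotone K ∧ Γ = ⋃ n, K n ∧
    ∀ n, IsCompact (K n) ∧ ContinuousOn (fun p : X × X => dL.dist p.1 p.2) (K n)

/-- The set `Γ'`: pairs `(w₀, z_I)` such that `(w₀, z₀), …, (w_I, z_I) ∈ Γ` form a cycle of
total cost `0` (all `d_L (wᵢ, zᵢ)` being finite, this is the equality of the two sums). -/
def cycleSet (dL : ExtDist X) (Γ : Set (X × X)) : Set (X × X) :=
  {q | ∃ (n : ℕ) (p : Fin (n + 1) → X × X), (∀ i, p i ∈ Γ) ∧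
    (p 0).1 = q.1 ∧ (p (Fin.last n)).2 = q.2 ∧
    ∑ i, dL.dist (p (i + 1)).1 (p i).2 = ∑ i, dL.dist (p i).1 (p i).2}

/-- The set `G` of oriented transport rays. -/
def orientedRays (dL : ExtDist X) (Γ : Set (X × X)) : Set (X × X) :=
  {q | ∃ p ∈ cycleSet dL Γ,
    dL.dist p.1 q.1 + dL.dist q.1 q.2 + dL.dist q.2 p.2 = dL.dist p.1 p.2}

/-- The set `R = G ∪ G⁻¹` of transport rays. -/
def rays (dL : ExtDist X) (Γ : Set (X × X)) : Set (X × X) :=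
  {q | (q.1, q.2) ∈ orientedRays dL Γ ∨ (q.2, q.1) ∈ orientedRays dL Γ}

/-- The ray `R(x)`. -/
def ray (dL : ExtDist X) (Γ : Set (X × X)) (x : X) : Set X :=
  {y | (x, y) ∈ rays dL Γ}

/-- The transport set without endpoints `𝒯`. -/
def transportSet (dL : ExtDist X) (Γ : Set (X × X)) : Set X :=
  {x | (∃ w, w ≠ x ∧ (w, x) ∈ orientedRays dL Γ) ∧ ∃ z, z ≠ x ∧ (x, z) ∈ orientedRays dL Γ}

/-- The transport set with endpoints `𝒯ₑ`. -/
def transportSetE (dL : ExtDist X) (Γ : Set (X × X)) : Set X :=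
  {x | (∃ w, w ≠ x ∧ (w, x) ∈ orientedRays dL Γ) ∨ ∃ z, z ≠ x ∧ (x, z) ∈ orientedRays dL Γ}

/-- `f` restricts to a `μ`-measurable cross section (quotient map) `𝒯 → 𝒯` of the ray
relation on `𝒯`. The values of `f` off `𝒯` are irrelevant. -/
structure IsCrossSection [MeasurableSpace X] (dL : ExtDist X) (Γ : Set (X × X))
    (μ : Measure X) (f : X → X) : Prop where
  mapsTo : ∀ x ∈ transportSet dL Γ, f x ∈ transportSet dL Γ
  mem_ray : ∀ x ∈ transportSet dL Γ, f x ∈ ray dL Γ x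
  eq_of_mem_ray : ∀ x ∈ transportSet dL Γ, ∀ y ∈ transportSet dL Γ, y ∈ ray dL Γ x → f x = f y
  aemeasurable : AEMeasurable f (μ.restrict (transportSet dL Γ))

/-- The ray map `g` as a graph, `rayMap dL Γ f y t x` meaning `g(y, t) = x`: here `y` is in the
cross section `f(𝒯)` and `x` is the point of the ray of `y` at signed distance `t` from `y`. -/
def rayMap (dL : ExtDist X) (Γ : Set (X × X)) (f : X → X) (y : X) (t : ℝ) (x : X) : Prop :=
  y ∈ f '' transportSet dL Γ ∧
    ((0 ≤ t ∧ (y, x) ∈ orientedRays dL Γ ∧ dL.dist x y = ENNReal.ofReal t) ∨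
      (t < 0 ∧ (x, y) ∈ orientedRays dL Γ ∧ dL.dist x y = ENNReal.ofReal (-t)))

/-- The `t`-evolution `A_t = g (g⁻¹(A) + (0, t))` of a set `A` along the rays. -/
def evolution (dL : ExtDist X) (Γ : Set (X × X)) (f : X → X) (A : Set X) (t : ℝ) : Set X :=
  {x' | ∃ y s, (∃ x ∈ A, rayMap dL Γ f y s x) ∧ rayMap dL Γ f y (s + t) x'}

/-- The absolute continuity assumption, for Borel subsets of `E`: `μ(A) > 0` implies
`∫₀^∞ μ(A_t) dt > 0`. -/
def EvolutionPositive [MeasurableSpace X]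
    (dL : ExtDist X) (Γ : Set (X × X)) (μ : Measure X) (f : X → X) (E : Set X) : Prop :=
  ∀ A : Set X, MeasurableSet A → A ⊆ E → 0 < μ A →
    0 < ∫⁻ t in Ioi (0 : ℝ), μ (evolution dL Γ f A t)

/-- The quotient measure `m = f_♯ (μ ⌞ 𝒯)`. -/
noncomputable def quotientMeasure [MeasurableSpace X] (dL : ExtDist X) (Γ : Set (X × X))
    (μ : Measure X) (f : X → X) : Measure X :=
  (μ.restrict (transportSet dL Γ)).map f

/-- `y ↦ κ y` is a disintegration `μ ⌞ 𝒯 = ∫ κ y m(dy)`, strongly consistent with `f`: the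
conditional probability `κ y` is concentrated on the fibre `f⁻¹(y)`, the ray of `y` in `𝒯`. -/
structure IsRayDisintegration [MeasurableSpace X] (dL : ExtDist X) (Γ : Set (X × X))
    (μ : Measure X) (f : X → X) (κ : X → Measure X) : Prop where
  prob : ∀ y ∈ f '' transportSet dL Γ, IsProbabilityMeasure (κ y)
  aemeasurable : ∀ B : Set X, MeasurableSet B →
    AEMeasurable (fun y => κ y B) (quotientMeasure dL Γ μ f)
  consistent : ∀ B C : Set X, MeasurableSet B → MeasurableSet C →
    μ (transportSet dL Γ ∩ B ∩ f ⁻¹' C) = ∫⁻ y in C, κ y B ∂(quotientMeasure dL Γ μ f)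
  strong : ∀ y ∈ f '' transportSet dL Γ, κ y {x | x ∈ transportSet dL Γ ∧ f x = y}ᶜ = 0

end Metric

end MongeRays

/-! Splicing two zero-cost cycles gives a longer cycle. Cyclical monotonicity of that cycle forces
`d_L` to be additive along `G`-chains and `G` to be transitive (`orientedRays_raySystem`).
Non-branching then makes the ray through an interior point a single geodesic (`seg_of_seg_seg`,
`exists_isGeodesic`), so an interior point and a signed arc length determine at most one point. All
these relations are analytic, hence null measurable for the measures involved.

For the cross section, local compactness of geodesics makes a ray meet a small closed neighbourhood
of one of its points in a compact set of parameters, which has a minimum. A countable family of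
closed balls, and the first ball for which a minimum exists, select one point per ray
(`exists_crossSection`).

The evolution hypothesis enters in contrapositive form: a Borel set whose forward displacements are
null for almost every time is null. Final points have no displacement. Displacements of initial
points are disjoint among interior points, so all but countably many are null. Hence endpoints are
null. If a set of interior points meets almost every ray in a Lebesgue-null set of parameters,
Fubini makes almost all its displacements null, so it is null (`measure_eq_zero_of_ae_ray`).
Therefore the part of `μ` on the interior points has a density with respect to the image of `m × ℒ¹`
under the ray map. Slicing this density along the rays gives an absolutely continuous
disintegration, and uniqueness of disintegrations passes the property to every `κ`
(`ae_absolutelyContinuous`). The Hausdorff statement follows because arc length parametrization is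
an isometry. -/

namespace MongeRays

open Filter Topology

/-! ### Analytic sets and their universal measurability. -/

section Analytic

/-- A continuous image of the Baire space is inner regular by images of compact sets. -/
theorem exists_isCompact_image_le_measure {X : Type*} [TopologicalSpace X] [PolishSpace X]
    [MeasurableSpace X] [BorelSpace X] (μ : Measure X) [IsFiniteMeasure μ] {f : (ℕ → ℕ) → X}
    (hf : Continuous f) {c : ℝ≥0∞} (hc : c < μ (range f)) :
    ∃ K : Set (ℕ → ℕ), IsCompact K ∧ c ≤ μ (f '' K) := by
  -- Bounding the `k`-th coordinate by larger and larger `n` exhausts `A`, so some bound keeps the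
  -- measure above `c`. Iterating over `k` produces a compact box.
  have step : ∀ (k : ℕ) (A : Set (ℕ → ℕ)), c < μ (f '' A) →
      ∃ n : ℕ, c < μ (f '' (A ∩ {x | x k ≤ n})) := by
    intro k A hA
    have hU : f '' A = ⋃ n : ℕ, f '' (A ∩ {x | x k ≤ n}) := by
      rw [← image_iUnion, ← inter_iUnion]
      congr 1
      refine (inter_eq_left.2 fun x _ => mem_iUnion.2 ⟨x k, ?_⟩).symm
      exact le_refl (x k)
    have hm : Monotone fun n : ℕ => f '' (A ∩ {x | x k ≤ n}) := fun a b hab =>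
      image_mono (inter_subset_inter_right _ fun x (hx : x k ≤ a) => (hx.trans hab : x k ≤ b))
    rw [hU, hm.measure_iUnion] at hA
    exact lt_iSup_iff.1 hA
  choose! N hN using step
  let A : ℕ → Set (ℕ → ℕ) := fun k => Nat.rec univ (fun k A => A ∩ {x | x k ≤ N k A}) k
  have hA : ∀ k, c < μ (f '' A k) := by
    intro k
    induction k with
    | zero => simpa [A] using hc
    | succ k ih => exact hN k (A k) ih
  let n : ℕ → ℕ := fun k => N k (A k)
  have hAn : ∀ k x, x ∈ A k ↔ ∀ i < k, x i ≤ n i := by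
    intro k x
    induction k with
    | zero => simp [A]
    | succ k ih =>
      constructor
      · rintro ⟨h1, h2⟩ i hi
        rcases Nat.lt_succ_iff_lt_or_eq.1 hi with h | rfl
        · exact ih.1 h1 i h
        · exact h2
      · intro h
        exact ⟨ih.2 fun i hi => h i (hi.trans k.lt_succ_self), h k k.lt_succ_self⟩
  let K : Set (ℕ → ℕ) := Set.pi univ fun i => Iic (n i)
  have hK : IsCompact K := isCompact_univ_pi fun i => (finite_Iic (n i)).isCompact
  refine ⟨K, hK, ?_⟩
  let := TopologicalSpace.upgradeIsCompletelyMetrizable X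
  -- Otherwise the image of the box lies in an open `U` of measure below `c`, and every `A k` has a
  -- point mapped outside `U`. Truncating these points into the box changes no coordinate `i < k`,
  -- so a limit point of the truncations contradicts the continuity of `f`.
  by_contra! hlt
  obtain ⟨U, hKU, hU, hUc⟩ := (f '' K).exists_isOpen_lt_of_lt c hlt
  have hout : ∀ k, ∃ x ∈ A k, f x ∉ U := by
    intro k
    by_contra! h
    exact absurd ((hA k).trans_le (measure_mono (image_subset_iff.2 h))) (not_lt.2 hUc.le)
  choose x hxA hxU using hout
  obtain ⟨y, hyK, φ, hφ, hlim⟩ := hK.tendsto_subseq (x := fun k i => min (x k i) (n i))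
    fun k i _ => (min_le_right (x k i) (n i) : min (x k i) (n i) ≤ n i)
  have hlim' : Tendsto (x ∘ φ) atTop (𝓝 y) := by
    rw [tendsto_pi_nhds] at hlim ⊢
    intro i
    refine (hlim i).congr' ?_
    filter_upwards [eventually_gt_atTop i] with k hk
    exact min_eq_left ((hAn _ _).1 (hxA (φ k)) i (hk.trans_le hφ.le_apply))
  have hev := (hf.tendsto y).comp hlim' (hU.mem_nhds (hKU (mem_image_of_mem f hyK)))
  obtain ⟨k, hk⟩ := (mem_map.1 hev |> Eventually.exists)
  exact hxU _ hk

/-- Analytic sets are universally measurable. -/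
theorem _root_.MeasureTheory.AnalyticSet.nullMeasurableSet {X : Type*} [TopologicalSpace X] [PolishSpace X]
    [MeasurableSpace X] [BorelSpace X] {s : Set X} (hs : AnalyticSet s) (μ : Measure X)
    [SFinite μ] : NullMeasurableSet s μ := by
  refine NullMeasurableSet.mono_ac (μ := μ.toFinite) ?_ (absolutelyContinuous_toFinite μ)
  generalize μ.toFinite = ν, (inferInstance : IsFiniteMeasure μ.toFinite) = _i
  rw [AnalyticSet] at hs
  rcases hs with rfl | ⟨f, hf, rfl⟩
  · exact nullMeasurableSet_empty
  rcases eq_or_ne (ν (range f)) 0 with h0 | h0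
  · exact NullMeasurableSet.of_null h0
  obtain ⟨u, -, hu, hlim⟩ := exists_seq_strictMono_tendsto' (pos_iff_ne_zero.2 h0)
  choose K hK hle using fun n => exists_isCompact_image_le_measure ν hf (hu n).2
  have hBm : MeasurableSet (⋃ n, f '' K n) :=
    MeasurableSet.iUnion fun n => ((hK n).image hf).isClosed.measurableSet
  have hBs : (⋃ n, f '' K n) ⊆ range f := iUnion_subset fun n => image_subset_range _ _
  have hge : ν (range f) ≤ ν (⋃ n, f '' K n) :=
    le_of_tendsto' hlim fun n => (hle n).trans (measure_mono (subset_iUnion (fun n => f '' K n) n))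
  refine (hBm.nullMeasurableSet (μ := ν)).congr ?_
  exact ae_eq_of_subset_of_measure_ge hBs hge hBm.nullMeasurableSet (measure_ne_top _ _)

theorem _root_.MeasureTheory.AnalyticSet.inter' {X : Type*} [TopologicalSpace X] [T2Space X] {s t : Set X}
    (hs : AnalyticSet s) (ht : AnalyticSet t) : AnalyticSet (s ∩ t) := by
  rw [inter_eq_iInter]
  exact AnalyticSet.iInter (by rintro (_ | _) <;> assumption)

theorem _root_.MeasureTheory.AnalyticSet.union' {X : Type*} [TopologicalSpace X] {s t : Set X}
    (hs : AnalyticSet s) (ht : AnalyticSet t) : AnalyticSet (s ∪ t) := by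
  rw [union_eq_iUnion]
  exact AnalyticSet.iUnion (by rintro (_ | _) <;> assumption)

/-- The projection of an analytic subset of a product is analytic. -/
theorem _root_.MeasureTheory.AnalyticSet.exists_snd {X Y : Type*} [TopologicalSpace X] [TopologicalSpace Y]
    {s : Set (X × Y)} (hs : AnalyticSet s) : AnalyticSet {x | ∃ y, (x, y) ∈ s} := by
  convert hs.image_of_continuous continuous_fst using 1
  ext x
  simp

end Analytic

/-! ### Order and geometry of rays without branching. -/

section RaySystem

variable {X : Type*} {dL : ExtDist X} {G : X → X → Prop}

/-- An oriented ray relation: finite distances, transitive with additive distance along chains, and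
stable under passing to intermediate points. -/
structure RaySystem (dL : ExtDist X) (G : X → X → Prop) : Prop where
  finite : ∀ {x y}, G x y → dL.dist x y ≠ ∞
  trans : ∀ {x y z}, G x y → G y z → G x z
  add : ∀ {x y z}, G x y → G y z → dL.dist x z = dL.dist x y + dL.dist y z
  between : ∀ {x y z}, G x z → dL.dist x y + dL.dist y z = dL.dist x z → G x y ∧ G y z

theorem RaySystem.flip (h : RaySystem dL G) : RaySystem dL (flip G) where
  finite := fun {x y} hxy => dL.symm y x ▸ h.finite hxy
  trans := fun hxy hyz => h.trans hyz hxy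
  add := fun {x y z} hxy hyz => by
    rw [dL.symm x z, dL.symm x y, dL.symm y z, add_comm]; exact h.add hyz hxy
  between := fun {x y z} hxz he => by
    rw [dL.symm x z, dL.symm x y, dL.symm y z, add_comm] at he
    exact (h.between hxz he).symm

/-- `y` lies after `x` along a ray, at distance `a`. -/
def Seg (dL : ExtDist X) (G : X → X → Prop) (x : X) (a : ℝ) (y : X) : Prop :=
  0 ≤ a ∧ G x y ∧ dL.dist x y = ENNReal.ofReal a

/-- Points that are interior to a ray. -/
def Interior (G : X → X → Prop) (x : X) : Prop :=
  (∃ w, w ≠ x ∧ G w x) ∧ ∃ z, z ≠ x ∧ G x z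

/-- `x` lies on the ray of `y` at signed distance `t`. -/
def Along (dL : ExtDist X) (G : X → X → Prop) (y : X) (t : ℝ) (x : X) : Prop :=
  (0 ≤ t ∧ Seg dL G y t x) ∨ (t < 0 ∧ Seg dL G x (-t) y)

theorem seg_flip {x y : X} {a : ℝ} : Seg dL (flip G) x a y ↔ Seg dL G y a x := by
  simp only [Seg, flip, dL.symm x y]

theorem Interior.flip {x : X} (hx : Interior G x) : Interior (flip G) x :=
  ⟨hx.2, hx.1⟩

namespace RaySystem

variable (h : RaySystem dL G) {x y z y' : X} {a b c s t : ℝ}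
include h

theorem exists_seg (hxy : G x y) : ∃ a, Seg dL G x a y :=
  ⟨_, ENNReal.toReal_nonneg, hxy, (ENNReal.ofReal_toReal (h.finite hxy)).symm⟩

theorem seg_trans (h1 : Seg dL G x a y) (h2 : Seg dL G y b z) : Seg dL G x (a + b) z :=
  ⟨add_nonneg h1.1 h2.1, h.trans h1.2.1 h2.2.1, by
    rw [h.add h1.2.1 h2.2.1, h1.2.2, h2.2.2, ENNReal.ofReal_add h1.1 h2.1]⟩

theorem seg_between (h1 : Seg dL G x c z) (ha : 0 ≤ a) (hb : 0 ≤ b) (hab : a + b = c)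
    (hxy : dL.dist x y = ENNReal.ofReal a) (hyz : dL.dist y z = ENNReal.ofReal b) :
    Seg dL G x a y ∧ Seg dL G y b z := by
  have := h.between (y := y) h1.2.1 (by rw [hxy, hyz, h1.2.2, ← ENNReal.ofReal_add ha hb, hab])
  exact ⟨⟨ha, this.1, hxy⟩, hb, this.2, hyz⟩

theorem antisymm (h1 : G x y) (h2 : G y x) : x = y := by
  have := h.add h1 h2
  rw [dL.dist_self, eq_comm, add_eq_zero] at this
  exact dL.eq_of_dist_eq_zero _ _ this.1

theorem refl_right (h1 : G x y) : G y y :=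
  (h.between (y := y) h1 (by rw [dL.dist_self, add_zero])).2

omit h in
theorem seg_unique (h1 : Seg dL G x a y) (h2 : Seg dL G x b y) : a = b :=
  (ENNReal.ofReal_eq_ofReal_iff h1.1 h2.1).1 (h1.2.2.symm.trans h2.2.2)

omit h in
theorem seg_eq_zero (h1 : Seg dL G x a x) : a = 0 := by
  have := h1.2.2
  rw [dL.dist_self, eq_comm, ENNReal.ofReal_eq_zero] at this
  exact le_antisymm this h1.1

omit h in
theorem eq_of_seg_zero (h1 : Seg dL G x 0 y) : x = y :=
  dL.eq_of_dist_eq_zero _ _ (by rw [h1.2.2, ENNReal.ofReal_zero])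

omit h in
theorem seg_pos (h1 : Seg dL G x a y) (hne : x ≠ y) : 0 < a :=
  lt_of_le_of_ne h1.1 fun h0 => hne (eq_of_seg_zero (h0 ▸ h1))

omit h in
theorem seg_ne (h1 : Seg dL G x a y) (ha : 0 < a) : x ≠ y := by
  rintro rfl
  exact ha.ne' (seg_eq_zero h1)

end RaySystem

/-- A ray system in a geodesic space without branching. -/
structure GeodesicRaySystem (dL : ExtDist X) (G : X → X → Prop) : Prop extends
    RaySystem dL G where
  geodesic : ∀ x y, dL.dist x y ≠ ∞ → ∃ γ : ℝ → X,
    IsGeodesic dL (Icc 0 (dL.dist x y).toReal) γ ∧ γ 0 = x ∧ γ (dL.dist x y).toReal = y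
  nonBranching : NonBranching dL

namespace GeodesicRaySystem

variable (h : GeodesicRaySystem dL G) {x y z y' : X} {a b c s t : ℝ}
include h

protected theorem flip : GeodesicRaySystem dL (flip G) :=
  ⟨h.toRaySystem.flip, h.geodesic, h.nonBranching⟩

/-- A geodesic of the ambient space joining `G`-related points stays inside `G`, because `G` is
stable under intermediate points. -/
theorem exists_geodesic (h1 : Seg dL G x a y) :
    ∃ γ : ℝ → X, γ 0 = x ∧ γ a = y ∧ ∀ s ∈ Icc 0 a, ∀ t ∈ Icc 0 a, s ≤ t →
      Seg dL G (γ s) (t - s) (γ t) := by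
  obtain ⟨γ, hγ, h0, ha⟩ := h.geodesic x y (h.finite h1.2.1)
  rw [h1.2.2, ENNReal.toReal_ofReal h1.1] at hγ ha
  have key : ∀ t ∈ Icc 0 a, Seg dL G x t (γ t) ∧ Seg dL G (γ t) (a - t) y := by
    intro t ht
    refine h.seg_between h1 ht.1 (sub_nonneg.2 ht.2) (by ring) ?_ ?_
    · rw [← h0, hγ.2 0 (left_mem_Icc.2 h1.1) t ht, zero_sub, abs_neg, abs_of_nonneg ht.1]
    · rw [← ha, hγ.2 t ht a (right_mem_Icc.2 h1.1), abs_sub_comm,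
        abs_of_nonneg (sub_nonneg.2 ht.2)]
  refine ⟨γ, h0, ha, fun s hs t ht hst => ?_⟩
  refine (h.seg_between (key t ht).1 hs.1 (sub_nonneg.2 hst) (by ring) (key s hs).1.2.2 ?_).2
  rw [hγ.2 s hs t ht, abs_sub_comm, abs_of_nonneg (sub_nonneg.2 hst)]

theorem exists_split (h1 : Seg dL G x c z) (ha : 0 ≤ a) (hac : a ≤ c) :
    ∃ y, Seg dL G x a y ∧ Seg dL G y (c - a) z := by
  obtain ⟨γ, h0, hc, hγ⟩ := h.exists_geodesic h1
  refine ⟨γ a, ?_, ?_⟩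
  · simpa [h0] using hγ 0 ⟨le_rfl, h1.1⟩ a ⟨ha, hac⟩ ha
  · simpa [hc] using hγ a ⟨ha, hac⟩ c ⟨h1.1, le_rfl⟩ hac

/-- Rays do not branch at a point that has a predecessor. -/
theorem seg_of_seg_seg (hw : ∃ w, w ≠ x ∧ G w x) (h1 : Seg dL G x a y) (h2 : Seg dL G x b y')
    (hab : a ≤ b) : Seg dL G y (b - a) y' := by
  obtain ⟨w, hwx, hw⟩ := hw
  obtain ⟨r, hr⟩ := h.exists_seg hw
  have hr0 := RaySystem.seg_pos hr hwx
  obtain ⟨γ, h10, h1a, hγ⟩ := h.exists_geodesic h1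
  obtain ⟨η, h20, h2b, hη⟩ := h.exists_geodesic h2
  have hγ0 : ∀ s, 0 ≤ s → s ≤ a → Seg dL G x s (γ s) := fun s h0 hs => by
    simpa [h10] using hγ 0 ⟨le_rfl, h1.1⟩ s ⟨h0, hs⟩ h0
  have hη0 : ∀ s, 0 ≤ s → s ≤ a → Seg dL G x s (η s) := fun s h0 hs => by
    simpa [h20] using hη 0 ⟨le_rfl, h2.1⟩ s ⟨h0, hs.trans hab⟩ h0
  -- For `s ≤ r`, let `v` be the point at distance `s` before `x`. Then `x` is the midpoint between
  -- `v` and each of the two candidates, and non-branching identifies them.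
  have hbase : ∀ s, 0 ≤ s → s ≤ a → s ≤ r → γ s = η s := by
    intro s h0 hsa hsr
    obtain ⟨v, -, hv⟩ := h.exists_split hr (sub_nonneg.2 hsr) (sub_le_self r h0)
    rw [sub_sub_cancel] at hv
    have e1 := h.seg_trans hv (hγ0 s h0 hsa)
    have e2 := h.seg_trans hv (hη0 s h0 hsa)
    have e : (s + s) / 2 = s := by ring
    refine h.nonBranching (s + s) v x (γ s) (η s) (by linarith) ?_ e1.2.2 ?_ e2.2.2 ?_ <;> rw [e]
    exacts [hv.2.2, (hγ0 s h0 hsa).2.2, (hη0 s h0 hsa).2.2]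
  -- Once the curves agree at `s / 2`, that point is the midpoint between `x` and each of the two
  -- points at `s`, so the length of agreement doubles.
  have hdouble : ∀ n : ℕ, ∀ s, 0 ≤ s → s ≤ a → s ≤ 2 ^ n * r → γ s = η s := by
    intro n
    induction n with
    | zero => intro s h0 hsa hs; exact hbase s h0 hsa (by simpa using hs)
    | succ n ih =>
      intro s h0 hsa hs
      have hmid : γ (s / 2) = η (s / 2) := ih _ (by linarith) (by linarith) (by
        rw [pow_succ] at hs; linarith)
      have e : s - s / 2 = s / 2 := by ring
      have g1 := hγ (s / 2) ⟨by linarith, by linarith⟩ s ⟨h0, hsa⟩ (by linarith)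
      have g2 := hη (s / 2) ⟨by linarith, by linarith⟩ s ⟨h0, by linarith⟩ (by linarith)
      rw [e] at g1 g2
      rw [← hmid] at g2
      exact h.nonBranching s x (γ (s / 2)) (γ s) (η s) h0
        (hγ0 (s / 2) (by linarith) (by linarith)).2.2 (hγ0 s h0 hsa).2.2 g1.2.2
        (hη0 s h0 hsa).2.2 g2.2.2
  obtain ⟨n, hn⟩ := pow_unbounded_of_one_lt (a / r) (one_lt_two)
  have hEq := hdouble n a h1.1 le_rfl ((div_lt_iff₀ hr0).1 hn).le
  have := hη a ⟨h1.1, hab⟩ b ⟨h2.1, le_rfl⟩ hab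
  rwa [← hEq, h1a, h2b] at this

theorem seg_of_seg_seg' (hz : ∃ z, z ≠ x ∧ G x z) (h1 : Seg dL G y a x) (h2 : Seg dL G y' b x)
    (hab : a ≤ b) : Seg dL G y' (b - a) y :=
  seg_flip.1 (h.flip.seg_of_seg_seg hz (seg_flip.2 h1) (seg_flip.2 h2) hab)

omit h in
theorem along_of_seg (h1 : Seg dL G x a y) : Along dL G x a y := Or.inl ⟨h1.1, h1⟩

omit h in
theorem along_of_seg' (h1 : Seg dL G y a x) : Along dL G x (-a) y := by
  rcases h1.1.eq_or_lt with rfl | ha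
  · have := RaySystem.eq_of_seg_zero h1
    subst this
    exact Or.inl ⟨by simp, by simpa using h1⟩
  · exact Or.inr ⟨neg_lt_zero.2 ha, by simpa using h1⟩

theorem along_unique (h1 : Along dL G x s y) (h2 : Along dL G x t y) : s = t := by
  rcases h1 with ⟨h0, h1⟩ | ⟨h0, h1⟩ <;> rcases h2 with ⟨h0', h2⟩ | ⟨h0', h2⟩
  · exact RaySystem.seg_unique h1 h2
  · have := h.antisymm h1.2.1 h2.2.1
    subst this
    linarith [RaySystem.seg_eq_zero h2]
  · have := h.antisymm h1.2.1 h2.2.1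
    subst this
    linarith [RaySystem.seg_eq_zero h1]
  · linarith [RaySystem.seg_unique h1 h2]

theorem exists_along (hxy : G x y ∨ G y x) : ∃ t, Along dL G x t y := by
  rcases hxy with hxy | hxy
  · obtain ⟨a, ha⟩ := h.exists_seg hxy
    exact ⟨a, along_of_seg ha⟩
  · obtain ⟨a, ha⟩ := h.exists_seg hxy
    exact ⟨-a, along_of_seg' ha⟩

omit h in
theorem rel_of_along (h1 : Along dL G x t y) : G x y ∨ G y x :=
  h1.imp (fun h => h.2.2.1) (fun h => h.2.2.1)

/-- Points on the same side of `x` are compared by non-branching, forward or backward; points on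
opposite sides by additivity of the distance through `x`. -/
theorem seg_of_along_along (hx : Interior G x) (h1 : Along dL G x s y) (h2 : Along dL G x t z)
    (hst : s ≤ t) : Seg dL G y (t - s) z := by
  rcases h1 with ⟨h0, h1⟩ | ⟨h0, h1⟩ <;> rcases h2 with ⟨h0', h2⟩ | ⟨h0', h2⟩
  · exact h.seg_of_seg_seg hx.1 h1 h2 hst
  · linarith
  · have := h.seg_trans h1 h2
    rwa [neg_add_eq_sub] at this
  · have := h.seg_of_seg_seg' hx.2 h2 h1 (by linarith)
    rwa [neg_sub_neg] at this

theorem along_of_along_along (hx : Interior G x) (h1 : Along dL G x s y)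
    (h2 : Along dL G x t z) : Along dL G y (t - s) z := by
  rcases le_total s t with hst | hst
  · exact along_of_seg (h.seg_of_along_along hx h1 h2 hst)
  · have := along_of_seg' (h.seg_of_along_along hx h2 h1 hst)
    rwa [neg_sub] at this

theorem eq_of_along (hx : Interior G x) (h1 : Along dL G x s y) (h2 : Along dL G x s z) :
    y = z := by
  have := h.seg_of_along_along hx h1 h2 le_rfl
  rw [sub_self] at this
  exact RaySystem.eq_of_seg_zero this

/-- This makes the ray relation an equivalence on interior points. Interiority of the middle point
is essential: several rays may share an endpoint. -/
theorem rel_trans (hx : Interior G x) (h1 : G x y ∨ G y x) (h2 : G x z ∨ G z x) :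
    G y z ∨ G z y := by
  obtain ⟨s, hs⟩ := h.exists_along h1
  obtain ⟨t, ht⟩ := h.exists_along h2
  exact rel_of_along (h.along_of_along_along hx hs ht)

omit h in
theorem along_zero (hx : G x x) : Along dL G x 0 x :=
  Or.inl ⟨le_rfl, le_rfl, hx, by rw [dL.dist_self, ENNReal.ofReal_zero]⟩

theorem interior_refl (hx : Interior G x) : G x x :=
  let ⟨⟨_, _, hw⟩, _⟩ := hx
  h.refl_right hw

theorem along_trans (hx : Interior G x) (hy : Interior G y) (h1 : Along dL G x s y)
    (h2 : Along dL G y t z) : Along dL G x (s + t) z := by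
  obtain ⟨u, hu⟩ := h.exists_along
    (h.rel_trans hy (rel_of_along h1).symm (rel_of_along h2))
  have := h.along_unique h2 (h.along_of_along_along hx h1 hu)
  rwa [this, add_sub_cancel]

omit h in
theorem interior_between (hx : Interior G x) (hz : Interior G z) (h1 : G x y) (h2 : G y z) :
    Interior G y := by
  rcases eq_or_ne x y with rfl | hxy
  · exact hx
  rcases eq_or_ne z y with rfl | hzy
  · exact hz
  exact ⟨⟨x, hxy, h1⟩, z, hzy, h2⟩

/-- The parameters of the interior points of the ray of `x`, measured from `x`. -/
def _root_.MongeRays.rayInterval (dL : ExtDist X) (G : X → X → Prop) (x : X) : Set ℝ :=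
  {t | ∃ y, Interior G y ∧ Along dL G x t y}

/-- The arc length parametrization of the ray of `x` by an interval of the line. -/
theorem exists_isGeodesic (hx : Interior G x) : ∃ γ : ℝ → X,
    IsGeodesic dL (rayInterval dL G x) γ ∧
      ∀ t ∈ rayInterval dL G x, Interior G (γ t) ∧ Along dL G x t (γ t) := by
  have : ∀ t, ∃ y, t ∈ rayInterval dL G x → Interior G y ∧ Along dL G x t y := by
    intro t
    by_cases ht : t ∈ rayInterval dL G x
    · obtain ⟨y, hy⟩ := ht
      exact ⟨y, fun _ => hy⟩
    · exact ⟨x, fun h => (ht h).elim⟩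
  choose γ hγ using this
  refine ⟨γ, ⟨⟨fun s hs t ht u hu => ?_⟩, fun s hs t ht => ?_⟩, hγ⟩
  · obtain ⟨hsI, hsA⟩ := hγ s hs
    obtain ⟨htI, htA⟩ := hγ t ht
    have hseg := h.seg_of_along_along hx hsA htA (hu.1.trans hu.2)
    obtain ⟨y, hy1, hy2⟩ := h.exists_split hseg (sub_nonneg.2 hu.1) (by linarith [hu.2])
    refine ⟨y, interior_between hsI htI hy1.2.1 hy2.2.1, ?_⟩
    have := h.along_trans hx hsI hsA (along_of_seg hy1)
    rwa [add_sub_cancel] at this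
  · obtain ⟨hsI, hsA⟩ := hγ s hs
    obtain ⟨htI, htA⟩ := hγ t ht
    rcases le_total s t with hst | hst
    · rw [(h.seg_of_along_along hx hsA htA hst).2.2, abs_sub_comm,
        abs_of_nonneg (sub_nonneg.2 hst)]
    · rw [dL.symm, (h.seg_of_along_along hx htA hsA hst).2.2, abs_of_nonneg (sub_nonneg.2 hst)]

end GeodesicRaySystem

end RaySystem

/-! ### Zero-cost cycles and the ray structure of `G`. -/

section Cycles

variable {X : Type*} {dL : ExtDist X} {Γ : Set (X × X)}

/-- The cost of the links `d_L (wᵢ₊₁, zᵢ)`, `i < n`, of an open chain. -/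
noncomputable def linkCost (dL : ExtDist X) (p : ℕ → X × X) (n : ℕ) : ℝ≥0∞ :=
  ∑ i ∈ Finset.range n, dL.dist (p (i + 1)).1 (p i).2

/-- The cost of the pairs `(wᵢ, zᵢ)`, `i ≤ n`, of a chain. -/
noncomputable def pairCost (dL : ExtDist X) (p : ℕ → X × X) (n : ℕ) : ℝ≥0∞ :=
  ∑ i ∈ Finset.range (n + 1), dL.dist (p i).1 (p i).2

theorem sum_fin_pair (p : ℕ → X × X) (n : ℕ) :
    ∑ i : Fin (n + 1), dL.dist (p i).1 (p i).2 = pairCost dL p n :=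
  Fin.sum_univ_eq_sum_range (fun i => dL.dist (p i).1 (p i).2) (n + 1)

theorem sum_fin_link (p : ℕ → X × X) (n : ℕ) :
    ∑ i : Fin (n + 1), dL.dist (p ((i + 1 : Fin (n + 1)) : ℕ)).1 (p i).2 =
      linkCost dL p n + dL.dist (p 0).1 (p n).2 := by
  rw [Fin.sum_univ_castSucc]
  congr 1
  · rw [linkCost, ← Fin.sum_univ_eq_sum_range (fun i => dL.dist (p (i + 1)).1 (p i).2) n]
    refine Finset.sum_congr rfl fun i _ => ?_
    simp
  · simp

theorem CyclicallyMonotone.pairCost_le (h : CyclicallyMonotone dL Γ) {p : ℕ → X × X} {n : ℕ}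
    (hp : ∀ i ≤ n, p i ∈ Γ) : pairCost dL p n ≤ linkCost dL p n + dL.dist (p 0).1 (p n).2 := by
  rw [← sum_fin_pair, ← sum_fin_link]
  exact h n (fun i => p i) fun i => hp i i.is_le

/-- Open chains indexed by `ℕ`, with the closing link split off, can be concatenated without cyclic
index arithmetic. -/
theorem mem_cycleSet {q : X × X} : q ∈ cycleSet dL Γ ↔ ∃ (n : ℕ) (p : ℕ → X × X),
    (∀ i ≤ n, p i ∈ Γ) ∧ (p 0).1 = q.1 ∧ (p n).2 = q.2 ∧
      linkCost dL p n + dL.dist q.1 q.2 = pairCost dL p n := by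
  constructor
  · rintro ⟨n, p, hp, h0, hn, he⟩
    have hval : ∀ i : Fin (n + 1), p (Fin.ofNat (n + 1) (i : ℕ)) = p i := fun i => by
      congr 1; ext; simp
    have h1 := sum_fin_pair (dL := dL) (fun i => p (Fin.ofNat (n + 1) i)) n
    have h2 := sum_fin_link (dL := dL) (fun i => p (Fin.ofNat (n + 1) i)) n
    simp only [hval] at h1 h2
    have hlast : p (Fin.ofNat (n + 1) n) = p (Fin.last n) := by congr 1; ext; simp
    have hzero : p (Fin.ofNat (n + 1) 0) = p 0 := by congr 1
    refine ⟨n, fun i => p (Fin.ofNat (n + 1) i), fun i _ => hp _, ?_, ?_, ?_⟩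
    · simp only [hzero, h0]
    · simp only [hlast, hn]
    · rw [← h1, ← he, h2]
      simp only [hzero, hlast, h0, hn]
  · rintro ⟨n, p, hp, h0, hn, he⟩
    refine ⟨n, fun i => p i, fun i => hp i i.is_le, h0, by simpa using hn, ?_⟩
    rw [sum_fin_pair, sum_fin_link, h0, hn, he]

theorem pairCost_ne_top (hfin : ∀ p ∈ Γ, dL.dist p.1 p.2 < ∞) {p : ℕ → X × X} {n : ℕ}
    (hp : ∀ i ≤ n, p i ∈ Γ) : pairCost dL p n ≠ ∞ :=
  (ENNReal.sum_lt_top.2 fun i hi =>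
    hfin _ (hp i (Nat.lt_succ_iff.1 (Finset.mem_range.1 hi)))).ne

theorem dist_ne_top_of_mem_cycleSet (hfin : ∀ p ∈ Γ, dL.dist p.1 p.2 < ∞) {q : X × X}
    (hq : q ∈ cycleSet dL Γ) : dL.dist q.1 q.2 ≠ ∞ := by
  obtain ⟨n, p, hp, h0, hn, he⟩ := mem_cycleSet.1 hq
  have := pairCost_ne_top hfin hp
  rw [← he] at this
  exact fun h => this (by rw [h, add_top])

/-- Two pairs of `Γ'` satisfy the two-point monotonicity inequality, and in the case of equality
the exchanged pair is again in `Γ'`. -/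
theorem cycleSet_exchange (hmon : CyclicallyMonotone dL Γ)
    (hfin : ∀ p ∈ Γ, dL.dist p.1 p.2 < ∞) {w z w' z' : X} (h : (w, z) ∈ cycleSet dL Γ)
    (h' : (w', z') ∈ cycleSet dL Γ) :
    dL.dist w z + dL.dist w' z' ≤ dL.dist w' z + dL.dist w z' ∧
    (dL.dist w' z + dL.dist w z' = dL.dist w z + dL.dist w' z' → (w, z') ∈ cycleSet dL Γ) := by
  obtain ⟨n, p, hp, h0, hn, he⟩ := mem_cycleSet.1 h
  obtain ⟨m, q, hq, h0', hm, he'⟩ := mem_cycleSet.1 h'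
  simp only at h0 hn he h0' hm he'
  -- Concatenating the chains replaces the closing links `d_L(w, z)` and `d_L(w', z')` by the inner
  -- link `d_L(w', z)` and the new closing link `d_L(w, z')`.
  let r : ℕ → X × X := fun i => if i ≤ n then p i else q (i - (n + 1))
  have hr1 : ∀ i, i ≤ n → r i = p i := fun i hi => if_pos hi
  have hr2 : ∀ i, r (n + 1 + i) = q i := fun i => by
    simp only [r]
    rw [if_neg (by omega), Nat.add_sub_cancel_left]
  have hr : ∀ i ≤ n + 1 + m, r i ∈ Γ := by
    intro i hi
    rcases le_or_gt i n with h1 | h1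
    · rw [hr1 i h1]; exact hp i h1
    · obtain ⟨j, rfl⟩ := Nat.exists_eq_add_of_le (Nat.succ_le_of_lt h1)
      rw [hr2]; exact hq j (by omega)
  have hpair : pairCost dL r (n + 1 + m) = pairCost dL p n + pairCost dL q m := by
    simp only [pairCost]
    rw [add_assoc (n + 1), Finset.sum_range_add]
    congr 1
    · exact Finset.sum_congr rfl fun i hi => by rw [hr1 i (by simpa [Nat.lt_succ_iff] using hi)]
    · exact Finset.sum_congr rfl fun i hi => by rw [hr2]
  have hlink : linkCost dL r (n + 1 + m) =
      linkCost dL p n + dL.dist w' z + linkCost dL q m := by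
    simp only [linkCost]
    rw [Finset.sum_range_add, Finset.sum_range_succ]
    congr 1
    · congr 1
      · refine Finset.sum_congr rfl fun i hi => ?_
        have := Finset.mem_range.1 hi
        rw [hr1 i (by omega), hr1 (i + 1) (by omega)]
      · have := hr2 0
        rw [add_zero] at this
        rw [this, hr1 n le_rfl, h0', hn]
    · refine Finset.sum_congr rfl fun i hi => ?_
      rw [hr2, add_assoc (n + 1), hr2]
  have hr0 : (r 0).1 = w := by rw [hr1 0 (Nat.zero_le _), h0]
  have hrl : (r (n + 1 + m)).2 = z' := by rw [hr2, hm]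
  have hP := pairCost_ne_top hfin hp
  have hQ := pairCost_ne_top hfin hq
  have hL : linkCost dL p n ≠ ∞ := fun h => hP (by rw [← he, h, top_add])
  have hL' : linkCost dL q m ≠ ∞ := fun h => hQ (by rw [← he', h, top_add])
  constructor
  · have := hmon.pairCost_le hr
    rw [hpair, hlink, hr0, hrl, ← he, ← he'] at this
    refine (ENNReal.add_le_add_iff_left (ENNReal.add_ne_top.2 ⟨hL, hL'⟩)).1 ?_
    calc _ = _ := by ring
      _ ≤ _ := this
      _ = _ := by ring
  · intro heq
    refine mem_cycleSet.2 ⟨n + 1 + m, r, hr, hr0, hrl, ?_⟩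
    rw [hpair, hlink, ← he, ← he']
    calc _ = linkCost dL p n + linkCost dL q m + (dL.dist w' z + dL.dist w z') := by
          simp only; ring
      _ = _ := by rw [heq]; ring

/-- Let `(w, z)` and `(w', z')` in `Γ'` witness `(x, y)` and `(y, v)`. Monotonicity gives `d_L(w, z)
+ d_L(w', z') ≤ d_L(w', z) + d_L(w, z')`; the triangle inequality, through `y` and along `w, x, v,
z'`, gives the converse. All inequalities are thus equalities, which yields additivity and puts `(w,
z')` in `Γ'` as a witness for `(x, v)`. -/
theorem orientedRays_raySystem (hmon : CyclicallyMonotone dL Γ)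
    (hfin : ∀ p ∈ Γ, dL.dist p.1 p.2 < ∞) :
    RaySystem dL fun x y => (x, y) ∈ orientedRays dL Γ := by
  have hdist : ∀ {x y}, (x, y) ∈ orientedRays dL Γ → dL.dist x y ≠ ∞ := by
    rintro x y ⟨p, hp, he⟩ htop
    refine dist_ne_top_of_mem_cycleSet hfin hp ?_
    simp only at he
    rw [← he, htop, add_top, top_add]
  have htrans : ∀ {x y v}, (x, y) ∈ orientedRays dL Γ → (y, v) ∈ orientedRays dL Γ →
      (x, v) ∈ orientedRays dL Γ ∧ dL.dist x v = dL.dist x y + dL.dist y v := by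
    rintro x y v ⟨⟨w, z⟩, hp, he⟩ ⟨⟨w', z'⟩, hp', he'⟩
    simp only at he he'
    have hwz := dist_ne_top_of_mem_cycleSet hfin hp
    have hwz' := dist_ne_top_of_mem_cycleSet hfin hp'
    simp only at hwz hwz'
    obtain ⟨hle, hex⟩ := cycleSet_exchange hmon hfin hp hp'
    have t1 : dL.dist w' z ≤ dL.dist w' y + dL.dist y z := dL.triangle _ _ _
    have t2 : dL.dist w z' ≤ dL.dist w x + dL.dist x v + dL.dist v z' :=
      (dL.triangle _ v _).trans (add_le_add_left (dL.triangle _ _ _) _)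
    have t3 : dL.dist x v ≤ dL.dist x y + dL.dist y v := dL.triangle _ _ _
    have f1 : dL.dist w x + dL.dist x y + dL.dist y z ≠ ∞ := he ▸ hwz
    have f2 : dL.dist w' y + dL.dist y v + dL.dist v z' ≠ ∞ := he' ▸ hwz'
    simp only [ne_eq, ENNReal.add_eq_top, not_or] at f1 f2
    obtain ⟨⟨a1, a2⟩, a3⟩ := f1
    obtain ⟨⟨b1, b2⟩, b3⟩ := f2
    have a4 : dL.dist x v ≠ ∞ := ne_top_of_le_ne_top (ENNReal.add_ne_top.2 ⟨a2, b2⟩) t3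
    have a5 : dL.dist w' z ≠ ∞ := ne_top_of_le_ne_top (ENNReal.add_ne_top.2 ⟨b1, a3⟩) t1
    have a6 : dL.dist w z' ≠ ∞ := ne_top_of_le_ne_top
      (ENNReal.add_ne_top.2 ⟨ENNReal.add_ne_top.2 ⟨a1, a4⟩, b3⟩) t2
    rw [← he, ← he'] at hle
    have main : dL.dist w' z + dL.dist w z' = dL.dist w z + dL.dist w' z' ∧
        dL.dist x v = dL.dist x y + dL.dist y v ∧
        dL.dist w x + dL.dist x v + dL.dist v z' = dL.dist w z' := by
      rw [← he, ← he']
      generalize dL.dist w x = d1 at *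
      generalize dL.dist x y = d2 at *
      generalize dL.dist y z = d3 at *
      generalize dL.dist w' y = d4 at *
      generalize dL.dist y v = d5 at *
      generalize dL.dist v z' = d6 at *
      generalize dL.dist x v = d7 at *
      generalize dL.dist w' z = d8 at *
      generalize dL.dist w z' = d9 at *
      lift d1 to NNReal using a1
      lift d2 to NNReal using a2
      lift d3 to NNReal using a3
      lift d4 to NNReal using b1
      lift d5 to NNReal using b2
      lift d6 to NNReal using b3
      lift d7 to NNReal using a4
      lift d8 to NNReal using a5
      lift d9 to NNReal using a6
      norm_cast at *
      simp only [← NNReal.coe_le_coe, ← NNReal.coe_inj, NNReal.coe_add] at *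
      refine ⟨?_, ?_, ?_⟩ <;> linarith
    exact ⟨⟨(w, z'), hex main.1, main.2.2⟩, main.2.1⟩
  refine ⟨hdist, fun h1 h2 => (htrans h1 h2).1, fun h1 h2 => (htrans h1 h2).2, ?_⟩
  rintro x y z ⟨⟨w, v⟩, hp, he⟩ hxyz
  simp only at he
  have hwv := dist_ne_top_of_mem_cycleSet hfin hp
  constructor
  · refine ⟨(w, v), hp, le_antisymm ?_ ?_⟩
    · simp only
      rw [← he, ← hxyz]
      calc _ ≤ dL.dist w x + dL.dist x y + (dL.dist y z + dL.dist z v) :=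
            add_le_add_right (dL.triangle _ _ _) _
        _ = _ := by ring
    · exact (dL.triangle _ y _).trans (add_le_add_left (dL.triangle _ _ _) _)
  · refine ⟨(w, v), hp, le_antisymm ?_ ?_⟩
    · simp only
      rw [← he, ← hxyz]
      calc _ ≤ dL.dist w x + dL.dist x y + dL.dist y z + dL.dist z v :=
            add_le_add_left (add_le_add_left (dL.triangle _ _ _) _) _
        _ = _ := by ring
    · exact (dL.triangle _ z _).trans (add_le_add_left (dL.triangle _ _ _) _)

theorem orientedRays_geodesicRaySystem [MetricSpace X] [MeasurableSpace X]
    (hdL : IsGeodesicSetting dL) (hmon : CyclicallyMonotone dL Γ)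
    (hfin : ∀ p ∈ Γ, dL.dist p.1 p.2 < ∞) :
    GeodesicRaySystem dL fun x y => (x, y) ∈ orientedRays dL Γ :=
  ⟨orientedRays_raySystem hmon hfin, hdL.geodesic, hdL.nonBranching⟩

end Cycles

/-! ### Analyticity of `Γ'` and `G`. -/

section AnalyticRays

variable {X : Type*} [MetricSpace X] [PolishSpace X] [MeasurableSpace X] [BorelSpace X]
  {dL : ExtDist X} {Γ : Set (X × X)}

/-- For each length the zero-cost cycles form a Borel set in a finite power of `X × X`; only the
passage to the two end coordinates loses Borel measurability. -/
theorem analyticSet_cycleSet (hborel : Measurable fun p : X × X => dL.dist p.1 p.2)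
    (hΓ : MeasurableSet Γ) : AnalyticSet (cycleSet dL Γ) := by
  have : cycleSet dL Γ = ⋃ n : ℕ, (fun p : Fin (n + 1) → X × X => ((p 0).1, (p (Fin.last n)).2)) ''
      {p | (∀ i, p i ∈ Γ) ∧
        ∑ i, dL.dist (p (i + 1)).1 (p i).2 = ∑ i, dL.dist (p i).1 (p i).2} := by
    ext ⟨a, b⟩
    simp only [cycleSet, mem_ofPred_eq, mem_iUnion, mem_image, Prod.mk.injEq]
    constructor
    · rintro ⟨n, p, h1, h2, h3, h4⟩
      exact ⟨n, p, ⟨h1, h4⟩, h2, h3⟩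
    · rintro ⟨n, p, ⟨h1, h4⟩, h2, h3⟩
      exact ⟨n, p, h1, h2, h3, h4⟩
  rw [this]
  refine AnalyticSet.iUnion fun n => AnalyticSet.image_of_continuous ?_ (by fun_prop)
  refine MeasurableSet.analyticSet (MeasurableSet.inter ?_ ?_)
  · have : {p : Fin (n + 1) → X × X | ∀ i, p i ∈ Γ} = ⋂ i, (fun p => p i) ⁻¹' Γ := by
      ext; simp
    change MeasurableSet {p : Fin (n + 1) → X × X | ∀ i, p i ∈ Γ}
    rw [this]
    exact MeasurableSet.iInter fun i => measurable_pi_apply i hΓ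
  · refine measurableSet_eq_fun ?_ ?_
    · refine Finset.measurable_fun_sum _ fun i _ => ?_
      have : Measurable fun p : Fin (n + 1) → X × X => ((p (i + 1)).1, (p i).2) := by fun_prop
      exact hborel.comp this
    · exact Finset.measurable_fun_sum _ fun i _ => hborel.comp (measurable_pi_apply i)

theorem analyticSet_orientedRays (hborel : Measurable fun p : X × X => dL.dist p.1 p.2)
    (hΓ : MeasurableSet Γ) : AnalyticSet (orientedRays dL Γ) := by
  have : orientedRays dL Γ = {q | ∃ p : X × X, (q, p) ∈ Prod.snd ⁻¹' cycleSet dL Γ ∩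
      {r : (X × X) × (X × X) | dL.dist r.2.1 r.1.1 + dL.dist r.1.1 r.1.2 + dL.dist r.1.2 r.2.2 =
        dL.dist r.2.1 r.2.2}} := rfl
  rw [this]
  refine AnalyticSet.exists_snd (AnalyticSet.inter'
    ((analyticSet_cycleSet hborel hΓ).preimage continuous_snd) (MeasurableSet.analyticSet ?_))
  have hm : ∀ f g : (X × X) × (X × X) → X, Measurable f → Measurable g →
      Measurable fun r => dL.dist (f r) (g r) := fun f g hf hg => hborel.comp (hf.prodMk hg)
  exact measurableSet_eq_fun (((hm _ _ (by fun_prop) (by fun_prop)).add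
    (hm _ _ (by fun_prop) (by fun_prop))).add (hm _ _ (by fun_prop) (by fun_prop)))
    (hm _ _ (by fun_prop) (by fun_prop))

theorem IsMonotonePlan.measurableSet {μ ν : Measure X} {π : Measure (X × X)}
    (hπ : IsMonotonePlan dL μ ν π Γ) : MeasurableSet Γ := by
  obtain ⟨K, -, rfl, hK⟩ := hπ.sigmaCompact
  exact MeasurableSet.iUnion fun n => (hK n).1.isClosed.measurableSet

end AnalyticRays

/-! ### Construction of the measurable cross section. -/

section MeasurableRays

variable {X : Type*} [MetricSpace X] [PolishSpace X] [MeasurableSpace X] [BorelSpace X]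
  {dL : ExtDist X} {G : X → X → Prop}

/-- A geodesic ray system with analytic graph for a Borel distance, whose geodesics are continuous
and locally compact. -/
structure AnalyticRaySystem (dL : ExtDist X) (G : X → X → Prop) : Prop extends
    GeodesicRaySystem dL G where
  borel : Measurable fun p : X × X => dL.dist p.1 p.2
  analytic : AnalyticSet {p : X × X | G p.1 p.2}
  continuous : ∀ (I : Set ℝ) (γ : ℝ → X), IsGeodesic dL I γ → ContinuousOn γ I
  locallyCompact : ∀ (I : Set ℝ) (γ : ℝ → X), IsGeodesic dL I γ →
    ∀ s ∈ I, ∃ r > 0, IsCompact (I ∩ γ ⁻¹' Metric.closedBall (γ s) r)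

/-- `p` is the first of the interior points of the ray of `x` that belong to `B`. -/
def Leftmost (G : X → X → Prop) (B : Set X) (x p : X) : Prop :=
  Interior G p ∧ p ∈ B ∧ (G x p ∨ G p x) ∧
    ∀ y, Interior G y → y ∈ B → (G x y ∨ G y x) → G p y

/-- The infimum of the parameters at which the interior of the ray of `x` meets `B`. -/
noncomputable def hittingParam (dL : ExtDist X) (G : X → X → Prop) (B : Set X) (x : X) : EReal :=
  ⨅ t ∈ {t : ℝ | ∃ y, Interior G y ∧ y ∈ B ∧ Along dL G x t y}, (t : EReal)

namespace AnalyticRaySystem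

variable (h : AnalyticRaySystem dL G)
include h

omit [BorelSpace X] in
theorem analyticSet_rel : AnalyticSet {p : X × X | G p.2 p.1} :=
  h.analytic.preimage continuous_swap

theorem analyticSet_interior : AnalyticSet {x | Interior G x} := by
  have hne : AnalyticSet {p : X × X | p.2 ≠ p.1} :=
    (isOpen_ne_fun continuous_snd continuous_fst).measurableSet.analyticSet
  exact (hne.inter' h.analyticSet_rel).exists_snd.inter' (hne.inter' h.analytic).exists_snd

theorem analyticSet_seg : AnalyticSet {q : X × ℝ × X | Seg dL G q.1 q.2.1 q.2.2} := by
  have h1 : AnalyticSet {q : X × ℝ × X | G q.1 q.2.2} :=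
    h.analytic.preimage (f := fun q : X × ℝ × X => (q.1, q.2.2)) (by fun_prop)
  have h2 : MeasurableSet {q : X × ℝ × X | 0 ≤ q.2.1} :=
    measurableSet_le measurable_const (by fun_prop)
  have h3 : MeasurableSet {q : X × ℝ × X | dL.dist q.1 q.2.2 = ENNReal.ofReal q.2.1} := by
    have : Measurable fun q : X × ℝ × X => (q.1, q.2.2) := by fun_prop
    exact measurableSet_eq_fun (h.borel.comp this) (by fun_prop)
  exact h2.analyticSet.inter' (h1.inter' h3.analyticSet)

theorem analyticSet_along : AnalyticSet {q : X × ℝ × X | Along dL G q.1 q.2.1 q.2.2} := by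
  have h1 : MeasurableSet {q : X × ℝ × X | 0 ≤ q.2.1} :=
    measurableSet_le measurable_const (by fun_prop)
  have h2 : MeasurableSet {q : X × ℝ × X | q.2.1 < 0} :=
    measurableSet_lt (by fun_prop) measurable_const
  have h3 : AnalyticSet {q : X × ℝ × X | Seg dL G q.2.2 (-q.2.1) q.1} :=
    h.analyticSet_seg.preimage (f := fun q : X × ℝ × X => (q.2.2, -q.2.1, q.1)) (by fun_prop)
  exact (h1.analyticSet.inter' h.analyticSet_seg).union' (h2.analyticSet.inter' h3)

/-- The graph of the ray map, restricted to arrival points in `B` that are interior. -/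
theorem analyticSet_along_interior {B : Set X} (hB : MeasurableSet B) :
    AnalyticSet {q : X × ℝ × X | Interior G q.2.2 ∧ q.2.2 ∈ B ∧ Along dL G q.1 q.2.1 q.2.2} := by
  have hc : Continuous fun q : X × ℝ × X => q.2.2 := by fun_prop
  exact (h.analyticSet_interior.preimage hc).inter'
    ((hB.analyticSet.preimage hc).inter' h.analyticSet_along)

omit [MetricSpace X] [PolishSpace X] [MeasurableSpace X] [BorelSpace X] h in
theorem leftmost_congr (h : GeodesicRaySystem dL G) {x x' : X} (hx : Interior G x)
    (hx' : Interior G x') (hr : G x x' ∨ G x' x) (B : Set X) :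
    Leftmost G B x = Leftmost G B x' := by
  have : ∀ y, (G x y ∨ G y x) ↔ (G x' y ∨ G y x') := fun y =>
    ⟨h.rel_trans hx hr, h.rel_trans hx' hr.symm⟩
  funext p
  simp only [Leftmost, this]

-- `Leftmost` quantifies over all points of the ray, which hides its measurability. Attaining the
-- infimum `hittingParam` is instead an existential condition involving one measurable function.
omit [MetricSpace X] [PolishSpace X] [MeasurableSpace X] [BorelSpace X] h in
theorem leftmost_iff (h : GeodesicRaySystem dL G) {x p : X} (hx : Interior G x) {B : Set X} :
    Leftmost G B x p ↔ Interior G p ∧ p ∈ B ∧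
      ∃ t : ℝ, Along dL G x t p ∧ hittingParam dL G B x = t := by
  constructor
  · rintro ⟨hp, hpB, hrel, hleft⟩
    obtain ⟨t, ht⟩ := h.exists_along hrel
    refine ⟨hp, hpB, t, ht, le_antisymm (iInf₂_le t ⟨p, hp, hpB, ht⟩) (le_iInf₂ ?_)⟩
    rintro s ⟨y, hy, hyB, hs⟩
    rw [EReal.coe_le_coe_iff]
    by_contra! hlt
    have hG := (h.seg_of_along_along hx hs ht hlt.le).2.1
    have hpy := h.antisymm hG (hleft y hy hyB (GeodesicRaySystem.rel_of_along hs))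
    rw [hpy] at hs
    exact hlt.ne (h.along_unique hs ht)
  · rintro ⟨hp, hpB, t, ht, ha⟩
    refine ⟨hp, hpB, GeodesicRaySystem.rel_of_along ht, fun y hy hyB hr => ?_⟩
    obtain ⟨s, hs⟩ := h.exists_along hr
    have : hittingParam dL G B x ≤ s := iInf₂_le s ⟨y, hy, hyB, hs⟩
    rw [ha, EReal.coe_le_coe_iff] at this
    exact (h.seg_of_along_along hx ht hs this).2.1

theorem aemeasurable_hittingParam {B : Set X} (hB : MeasurableSet B) (μ : Measure X) [SFinite μ] :
    AEMeasurable (hittingParam dL G B) μ := by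
  suffices hIio : ∀ c, NullMeasurableSet (hittingParam dL G B ⁻¹' Iio c) μ from
    NullMeasurable.aemeasurable
      (measurable_of_Iio (δ := NullMeasurableSpace X μ) (f := hittingParam dL G B) hIio)
  intro c
  have : hittingParam dL G B ⁻¹' Iio c = {x | ∃ q : ℝ × X, (x, q) ∈
      {q : X × ℝ × X | Interior G q.2.2 ∧ q.2.2 ∈ B ∧ Along dL G q.1 q.2.1 q.2.2} ∩
      {q : X × ℝ × X | (q.2.1 : EReal) < c}} := by
    ext x
    simp only [hittingParam, mem_preimage, mem_Iio, iInf_lt_iff, mem_ofPred_eq, exists_prop,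
      Prod.exists, mem_inter_iff]
    constructor
    · rintro ⟨t, ⟨y, h1⟩, h2⟩
      exact ⟨t, y, h1, h2⟩
    · rintro ⟨t, y, h1, h2⟩
      exact ⟨t, ⟨y, h1⟩, h2⟩
  rw [this]
  have hm : MeasurableSet {q : X × ℝ × X | (q.2.1 : EReal) < c} :=
    measurableSet_lt (by fun_prop) measurable_const
  exact ((h.analyticSet_along_interior hB).inter' hm.analyticSet).exists_snd.nullMeasurableSet μ

theorem nullMeasurableSet_leftmost {B B' : Set X} (hB : MeasurableSet B) (hB' : MeasurableSet B')
    (μ : Measure X) [SFinite μ] :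
    NullMeasurableSet {x | Interior G x ∧ ∃ p ∈ B', Leftmost G B x p} μ := by
  have ha := h.aemeasurable_hittingParam hB μ
  have hr : AEMeasurable (fun x => (hittingParam dL G B x).toReal) μ := ha.ereal_toReal
  -- `toReal` sends `⊥` and `⊤` to `0`. The value `⊥` is excluded explicitly; `⊤` is excluded by the
  -- point `p`, whose parameter is a finite upper bound.
  have heq : {x | Interior G x ∧ ∃ p ∈ B', Leftmost G B x p} =
      {x | Interior G x} ∩ (hittingParam dL G B ⁻¹' {⊥}ᶜ ∩
        {x | ∃ p, Interior G p ∧ p ∈ B ∩ B' ∧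
          Along dL G x (hittingParam dL G B x).toReal p}) := by
    ext x
    simp only [mem_ofPred_eq, mem_inter_iff, mem_preimage, mem_compl_iff, mem_singleton_iff]
    refine and_congr_right fun hx => ?_
    constructor
    · rintro ⟨p, hpB', hp⟩
      obtain ⟨hpT, hpB, t, ht, hat⟩ := (leftmost_iff h.toGeodesicRaySystem hx).1 hp
      rw [hat]
      exact ⟨EReal.coe_ne_bot t, p, hpT, ⟨hpB, hpB'⟩, by rwa [EReal.toReal_coe]⟩
    · rintro ⟨hbot, p, hpT, ⟨hpB, hpB'⟩, hp⟩
      refine ⟨p, hpB', (leftmost_iff h.toGeodesicRaySystem hx).2 ⟨hpT, hpB, _, hp, ?_⟩⟩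
      have hle : hittingParam dL G B x ≤ ((hittingParam dL G B x).toReal : EReal) :=
        iInf₂_le _ ⟨p, hpT, hpB, hp⟩
      exact (EReal.coe_toReal (ne_top_of_le_ne_top (EReal.coe_ne_top _) hle) hbot).symm
  rw [heq]
  refine (h.analyticSet_interior.nullMeasurableSet μ).inter
    ((ha.nullMeasurable (measurableSet_singleton _).compl).inter ?_)
  -- A Borel representative of the parameter has a Borel graph, so the projection is analytic; the
  -- original set differs from it by a null set.
  have hgraph : MeasurableSet {q : X × ℝ × X | q.2.1 = hr.mk _ q.1} :=
    measurableSet_eq_fun (by fun_prop) (hr.measurable_mk.comp measurable_fst)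
  have hmk := ((h.analyticSet_along_interior (hB.inter hB')).inter'
    hgraph.analyticSet).exists_snd.nullMeasurableSet μ
  refine hmk.congr ?_
  filter_upwards [hr.ae_eq_mk] with x hx
  refine propext ?_
  change (∃ q : ℝ × X, (Interior G q.2 ∧ q.2 ∈ B ∩ B' ∧ Along dL G x q.1 q.2) ∧
    q.1 = hr.mk _ x) ↔ ∃ p, Interior G p ∧ p ∈ B ∩ B' ∧
      Along dL G x (hittingParam dL G B x).toReal p
  constructor
  · rintro ⟨⟨t, p⟩, h1, h2⟩
    simp only at h1 h2
    rw [hx, ← h2]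
    exact ⟨p, h1⟩
  · rintro ⟨p, hp⟩
    exact ⟨(_, p), hp, hx⟩

omit [PolishSpace X] [BorelSpace X] in
/-- A closed set that contains `x` and is small enough is met first at some point by the ray
of `x`. -/
theorem exists_leftmost {x : X} (hx : Interior G x) :
    ∃ r > 0, ∀ B, IsClosed B → x ∈ B → B ⊆ Metric.closedBall x r → ∃ p, Leftmost G B x p := by
  obtain ⟨γ, hγ, hγI⟩ := h.exists_isGeodesic hx
  have h0 := GeodesicRaySystem.along_zero (dL := dL) (h.interior_refl hx)
  have hI0 : (0 : ℝ) ∈ rayInterval dL G x := ⟨x, hx, h0⟩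
  have hγ0 : γ 0 = x := h.eq_of_along hx (hγI 0 hI0).2 h0
  obtain ⟨r, hr, hK⟩ := h.locallyCompact _ γ hγ 0 hI0
  refine ⟨r, hr, fun B hB hxB hBr => ?_⟩
  rw [hγ0] at hK
  -- Since `B` lies in the ball, these are all the parameters at which the ray visits `B`; the set
  -- contains `0`.
  have hS : IsCompact (rayInterval dL G x ∩ γ ⁻¹' Metric.closedBall x r ∩ γ ⁻¹' B) :=
    hK.of_isClosed_subset (((h.continuous _ γ hγ).mono inter_subset_left).preimage_isClosed_of_isClosed
      hK.isClosed hB) inter_subset_left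
  obtain ⟨t, ⟨⟨htI, -⟩, htB⟩, htmin⟩ := hS.exists_isLeast
    ⟨0, ⟨hI0, by rw [mem_preimage, hγ0]; exact Metric.mem_closedBall_self hr.le⟩,
      by rwa [mem_preimage, hγ0]⟩
  obtain ⟨htT, htA⟩ := hγI t htI
  refine ⟨γ t, htT, htB, GeodesicRaySystem.rel_of_along htA, fun y hy hyB hrel => ?_⟩
  obtain ⟨s, hs⟩ := h.exists_along hrel
  have hsI : s ∈ rayInterval dL G x := ⟨y, hy, hs⟩
  have hsy : γ s = y := h.eq_of_along hx (hγI s hsI).2 hs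
  have hts : t ≤ s := htmin ⟨⟨hsI, by rw [mem_preimage, hsy]; exact hBr hyB⟩,
    by rwa [mem_preimage, hsy]⟩
  exact (h.seg_of_along_along hx htA hs hts).2.1

omit [PolishSpace X] [MeasurableSpace X] [BorelSpace X] h in
theorem exists_closed_net [SecondCountableTopology X] [Nonempty X] : ∃ B : ℕ → Set X,
    (∀ n, IsClosed (B n)) ∧ ∀ x, ∀ r > 0, ∃ n, x ∈ B n ∧ B n ⊆ Metric.closedBall x r := by
  refine ⟨fun n => Metric.closedBall (TopologicalSpace.denseSeq X n.unpair.1)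
    (1 / ((n.unpair.2 : ℝ) + 1)), fun n => Metric.isClosed_closedBall, fun x r hr => ?_⟩
  obtain ⟨k, hk⟩ := exists_nat_one_div_lt (half_pos hr)
  obtain ⟨i, hi⟩ := (TopologicalSpace.denseRange_denseSeq X).exists_dist_lt x
    (Nat.one_div_pos_of_nat (n := k) (α := ℝ))
  refine ⟨Nat.pair i k, ?_, fun y hy => ?_⟩
  · simpa using hi.le
  · simp only [Nat.unpair_pair, Metric.mem_closedBall] at hy ⊢
    have := dist_triangle_right y x (TopologicalSpace.denseSeq X i)
    linarith

/-- The ray relation on interior points has a universally measurable cross section. -/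
theorem exists_crossSection [Nonempty X] (μ : Measure X) [SFinite μ] : ∃ f : X → X,
    (∀ x, Interior G x → Interior G (f x) ∧ (G x (f x) ∨ G (f x) x)) ∧
    (∀ x, Interior G x → ∀ y, Interior G y → (G x y ∨ G y x) → f x = f y) ∧
    AEMeasurable f μ := by
  classical
  obtain ⟨B, hBc, hB⟩ := exists_closed_net (X := X)
  -- The choice depends on the predicates alone, not on `x`, so points of one ray, which share their
  -- predicates, receive the same value.
  let F : (ℕ → X → Prop) → X := fun P =>
    if hP : ∃ n, ∃ p, P n p then (Nat.find_spec hP).choose else Classical.arbitrary X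
  have hFspec : ∀ P : ℕ → X → Prop, (∃ n, ∃ p, P n p) →
      ∃ n, P n (F P) ∧ ∀ k < n, ¬ ∃ p, P k p := by
    intro P hP
    refine ⟨Nat.find hP, ?_, fun k hk => Nat.find_min hP hk⟩
    simp only [F, dif_pos hP]
    exact (Nat.find_spec hP).choose_spec
  let f : X → X := fun x => if Interior G x then F fun n => Leftmost G (B n) x else x
  have hex : ∀ x, Interior G x → ∃ n, ∃ p, Leftmost G (B n) x p := by
    intro x hx
    obtain ⟨r, hr, hp⟩ := h.exists_leftmost hx
    obtain ⟨n, hxn, hn⟩ := hB x r hr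
    exact ⟨n, hp _ (hBc n) hxn hn⟩
  have hf : ∀ x, Interior G x →
      ∃ n, Leftmost G (B n) x (f x) ∧ ∀ k < n, ¬ ∃ p, Leftmost G (B k) x p := by
    intro x hx
    simp only [f, if_pos hx]
    exact hFspec _ (hex x hx)
  refine ⟨f, fun x hx => ?_, fun x hx y hy hxy => ?_, NullMeasurable.aemeasurable fun B' hB' => ?_⟩
  · obtain ⟨n, hn, -⟩ := hf x hx
    exact ⟨hn.1, hn.2.2.1⟩
  · simp only [f, if_pos hx, if_pos hy]
    simp only [leftmost_congr h.toGeodesicRaySystem hx hy hxy]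
  -- The pieces are indexed by the first `n` with a leftmost point. That point is unique by
  -- antisymmetry, so it must be `f x`.
  · have heq : f ⁻¹' B' = (⋃ n, ({x | Interior G x ∧ ∃ p ∈ B', Leftmost G (B n) x p} ∩
        ⋂ k ∈ Iio n, {x | Interior G x ∧ ∃ p ∈ univ, Leftmost G (B k) x p}ᶜ)) ∪
          ({x | Interior G x}ᶜ ∩ B') := by
      ext x
      by_cases hx : Interior G x
      · simp only [mem_preimage, mem_union, mem_iUnion, mem_inter_iff, mem_ofPred_eq, hx, true_and,
          mem_iInter, mem_Iio, mem_compl_iff, mem_univ, not_true, false_and, or_false]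
        obtain ⟨n, hn, hmin⟩ := hf x hx
        constructor
        · exact fun hfx => ⟨n, ⟨f x, hfx, hn⟩, hmin⟩
        · rintro ⟨m, ⟨p, hpB', hp⟩, hmmin⟩
          have hnm : n = m := by
            rcases lt_trichotomy n m with hlt | he | hlt
            · exact (hmmin n hlt ⟨_, hn⟩).elim
            · exact he
            · exact (hmin m hlt ⟨_, hp⟩).elim
          subst hnm
          have : f x = p := h.antisymm (hn.2.2.2 p hp.1 hp.2.1 hp.2.2.1)
            (hp.2.2.2 _ hn.1 hn.2.1 hn.2.2.1)
          rwa [this]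
      · simp [f, hx]
    rw [heq]
    refine NullMeasurableSet.union (NullMeasurableSet.iUnion fun n => ?_) ?_
    · refine (h.nullMeasurableSet_leftmost (hBc n).measurableSet hB' μ).inter ?_
      exact NullMeasurableSet.biInter (to_countable _) fun k _ =>
        (h.nullMeasurableSet_leftmost (hBc k).measurableSet MeasurableSet.univ μ).compl
    · exact (h.analyticSet_interior.nullMeasurableSet μ).compl.inter hB'.nullMeasurableSet

end AnalyticRaySystem

end MeasurableRays

/-! ### Forward displacement: null endpoints and the Fubini argument. -/

section Displacement

variable {X : Type*} [MetricSpace X] [PolishSpace X] [MeasurableSpace X] [BorelSpace X]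
  {dL : ExtDist X} {G : X → X → Prop} {μ : Measure X}

/-- The points reached from `A` by moving forward a distance `t` along the rays. -/
def displaced (dL : ExtDist X) (G : X → X → Prop) (A : Set X) (t : ℝ) : Set X :=
  {x' | ∃ x ∈ A, Seg dL G x t x'}

/-- A Borel subset of `E` all of whose forward displacements are negligible is negligible. -/
def DisplacementPositive (dL : ExtDist X) (G : X → X → Prop) (μ : Measure X) (E : Set X) : Prop :=
  ∀ A, MeasurableSet A → A ⊆ E → (∀ᵐ t ∂volume.restrict (Ioi 0), μ (displaced dL G A t) = 0) →
    μ A = 0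

/-- Points with a successor or a predecessor. -/
def NonIsolated (G : X → X → Prop) (x : X) : Prop :=
  (∃ w, w ≠ x ∧ G w x) ∨ ∃ z, z ≠ x ∧ G x z

-- Extends the hypothesis from Borel sets to null measurable ones, such as differences of analytic
-- sets, through a Borel subset of full measure.
omit [MetricSpace X] [PolishSpace X] [BorelSpace X] in
theorem DisplacementPositive.measure_eq_zero {E F : Set X}
    (hE : DisplacementPositive dL G μ E) (hF : NullMeasurableSet F μ) (hFE : F ⊆ E)
    (h0 : ∀ A, MeasurableSet A → A ⊆ F →
      ∀ᵐ t ∂volume.restrict (Ioi 0), μ (displaced dL G A t) = 0) : μ F = 0 := by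
  obtain ⟨A, hAF, hA, hAe⟩ := hF.exists_measurable_subset_ae_eq
  rw [← measure_congr hAe]
  exact hE A hA (hAF.trans hFE) (h0 A hA hAF)

omit [MetricSpace X] [PolishSpace X] [MeasurableSpace X] [BorelSpace X] in
theorem displaced_eq_empty {A : Set X} (hA : ∀ x ∈ A, ¬ ∃ z, z ≠ x ∧ G x z) {t : ℝ} (ht : 0 < t) :
    displaced dL G A t = ∅ := by
  refine eq_empty_of_forall_notMem ?_
  rintro x' ⟨x, hx, hs⟩
  exact hA x hx ⟨x', (RaySystem.seg_ne hs ht).symm, hs.2.1⟩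

omit [MetricSpace X] [PolishSpace X] [MeasurableSpace X] [BorelSpace X] in
theorem exists_pred_of_mem_displaced {A : Set X} {t : ℝ} (ht : 0 < t) {x : X}
    (hx : x ∈ displaced dL G A t) : ∃ w, w ≠ x ∧ G w x := by
  obtain ⟨w, -, hs⟩ := hx
  exact ⟨w, RaySystem.seg_ne hs ht, hs.2.1⟩

namespace AnalyticRaySystem

variable (h : AnalyticRaySystem dL G)
include h

theorem analyticSet_exists_pred : AnalyticSet {x | ∃ w, w ≠ x ∧ G w x} :=
  ((isOpen_ne_fun continuous_snd continuous_fst).measurableSet.analyticSet.inter'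
    h.analyticSet_rel).exists_snd

theorem analyticSet_exists_succ : AnalyticSet {x | ∃ z, z ≠ x ∧ G x z} :=
  ((isOpen_ne_fun continuous_snd continuous_fst).measurableSet.analyticSet.inter'
    h.analytic).exists_snd

/-- The graph of the backward displacement into `A`, restricted to interior points. -/
theorem analyticSet_displaced {A : Set X} (hA : MeasurableSet A) :
    AnalyticSet {q : X × ℝ | q.1 ∈ displaced dL G A q.2 ∩ {x | Interior G x}} := by
  have h1 : AnalyticSet {p : (X × ℝ) × X | p.2 ∈ A ∧ Seg dL G p.2 p.1.2 p.1.1} :=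
    (hA.analyticSet.preimage continuous_snd).inter'
      (h.analyticSet_seg.preimage (f := fun p : (X × ℝ) × X => (p.2, p.1.2, p.1.1)) (by fun_prop))
  exact h1.exists_snd.inter' (h.analyticSet_interior.preimage continuous_fst)

/-- Almost all points of the transport set with endpoints are interior. -/
theorem measure_nonIsolated_diff_interior [SFinite μ]
    (hpos : DisplacementPositive dL G μ {x | NonIsolated G x}) :
    μ ({x | NonIsolated G x} \ {x | Interior G x}) = 0 := by
  set P : Set X := {x | ∃ w, w ≠ x ∧ G w x}
  set S : Set X := {x | ∃ z, z ≠ x ∧ G x z}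
  have hP := h.analyticSet_exists_pred.nullMeasurableSet μ
  have hS := h.analyticSet_exists_succ.nullMeasurableSet μ
  have hsplit : {x | NonIsolated G x} \ {x | Interior G x} = (P \ S) ∪ (S \ P) := by
    ext x
    exact (by tauto : ∀ p q : Prop, (p ∨ q) ∧ ¬ (p ∧ q) ↔ (p ∧ ¬ q) ∨ (q ∧ ¬ p)) (x ∈ P) (x ∈ S)
  have hfinal : μ (P \ S) = 0 := by
    refine hpos.measure_eq_zero (hP.diff hS) (fun x hx => Or.inl hx.1) fun A hA hAF => ?_
    refine (ae_restrict_iff' measurableSet_Ioi).2 (Filter.Eventually.of_forall fun t ht => ?_)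
    rw [displaced_eq_empty (fun x hx => (hAF hx).2) ht, measure_empty]
  have hinitial : μ (S \ P) = 0 := by
    refine hpos.measure_eq_zero (hS.diff hP) (fun x hx => Or.inr hx.1) fun A hA hAF => ?_
    -- Points of `A` have no predecessor, so two of them on one ray coincide. Hence displacements at
    -- distinct times are disjoint among interior points, and only countably many have positive
    -- measure.
    have hcount : {t : ℝ | 0 < μ (displaced dL G A t ∩ {x | Interior G x})}.Countable := by
      refine Measure.countable_meas_pos_of_disjoint_iUnion₀ (fun t => ?_) fun s t hst => ?_
      · exact (h.analyticSet_displaced hA |>.preimage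
          (f := fun x : X => (x, t)) (by fun_prop)).nullMeasurableSet μ
      · refine Disjoint.aedisjoint (disjoint_left.2 ?_)
        rintro x ⟨⟨u, hu, hus⟩, hx⟩ ⟨⟨v, hv, hvs⟩, -⟩
        have huv : u = v := by
          have hini : ∀ {a b}, a ∈ A → b ∈ A → G a b → a = b := fun {a b} ha hb hab => by
            by_contra hne
            exact (hAF hb).2 ⟨a, hne, hab⟩
          rcases h.rel_trans hx (Or.inr hus.2.1) (Or.inr hvs.2.1) with hG | hG
          · exact hini hu hv hG
          · exact (hini hv hu hG).symm
        subst huv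
        exact hst (RaySystem.seg_unique hus hvs)
    have hae : ∀ᵐ t : ℝ, ¬ 0 < μ (displaced dL G A t ∩ {x | Interior G x}) :=
      hcount.ae_notMem volume
    refine (ae_restrict_iff' measurableSet_Ioi).2 ?_
    filter_upwards [hae] with t ht ht0
    -- Displaced points have a predecessor; those that are not interior are final points, already
    -- known to be null.
    refine measure_mono_null (t := (displaced dL G A t ∩ {x | Interior G x}) ∪ (P \ S)) ?_
      (measure_union_null (by simpa using ht) hfinal)
    intro x hx
    by_cases hxS : x ∈ S
    · exact Or.inl ⟨hx, exists_pred_of_mem_displaced ht0 hx, hxS⟩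
    · exact Or.inr ⟨exists_pred_of_mem_displaced ht0 hx, hxS⟩
  rw [hsplit]
  exact measure_union_null hfinal hinitial

/-- If sets of positive measure can be displaced anywhere, almost all points are interior. -/
theorem measure_compl_interior [SFinite μ] (hpos : DisplacementPositive dL G μ univ) :
    μ {x | Interior G x}ᶜ = 0 := by
  have hE := h.measure_nonIsolated_diff_interior
    (fun A hA _ => hpos A hA (subset_univ A) : DisplacementPositive dL G μ {x | NonIsolated G x})
  have hN : NullMeasurableSet {x | NonIsolated G x} μ :=
    (h.analyticSet_exists_pred.union' h.analyticSet_exists_succ).nullMeasurableSet μ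
  have hc : μ {x | NonIsolated G x}ᶜ = 0 := by
    refine hpos.measure_eq_zero hN.compl (subset_univ _) fun A hA hAF => ?_
    refine (ae_restrict_iff' measurableSet_Ioi).2 (Filter.Eventually.of_forall fun t ht => ?_)
    rw [displaced_eq_empty (fun x hx hz => hAF hx (Or.inr hz)) ht, measure_empty]
  refine measure_mono_null (fun x hx => ?_) (measure_union_null hE hc)
  by_cases hxN : NonIsolated G x
  · exact Or.inl ⟨hxN, hx⟩
  · exact Or.inr hxN

/-- A Borel set of interior points that meets almost every ray, counted through the cross section
`f`, in a Lebesgue negligible set of parameters is negligible. -/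
theorem measure_eq_zero_of_ae_ray [SFinite μ]
    (hpos : DisplacementPositive dL G μ {x | NonIsolated G x}) {f : X → X}
    (hf : ∀ x, Interior G x → Interior G (f x) ∧ (G x (f x) ∨ G (f x) x))
    (hfm : AEMeasurable f (μ.restrict {x | Interior G x})) {A : Set X} (hA : MeasurableSet A)
    (hAI : A ⊆ {x | Interior G x})
    (hnull : ∀ᵐ y ∂(μ.restrict {x | Interior G x}).map f,
      volume {t : ℝ | ∃ x ∈ A, Along dL G y t x} = 0) : μ A = 0 := by
  refine hpos A hA (fun x hx => Or.inl (hAI hx).1) ?_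
  have hI := h.analyticSet_interior.nullMeasurableSet μ
  have hW := (h.analyticSet_displaced hA).nullMeasurableSet (μ.prod volume)
  -- If `x` has parameter `σ` on the ray of `f x`, a point of `A` reaching `x` after time `t` has
  -- parameter `σ - t`. The slice at fixed `x` therefore lies in a reflection of a null set; the
  -- slices at fixed `t` are then null for almost every `t`.
  have hW0 : μ.prod volume {q : X × ℝ | q.1 ∈ displaced dL G A q.2 ∩ {x | Interior G x}} = 0 := by
    obtain ⟨W, hWs, hWm, hWe⟩ := hW.exists_measurable_subset_ae_eq
    rw [← measure_congr hWe, Measure.measure_prod_null hWm]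
    have hμ := (ae_restrict_iff'₀ hI).1 (ae_of_ae_map hfm hnull)
    filter_upwards [hμ] with x hx
    by_cases hxI : Interior G x
    · obtain ⟨hfI, hfr⟩ := hf x hxI
      obtain ⟨σ, hσ⟩ := h.exists_along hfr.symm
      refine measure_mono_null (t := (fun t => σ - t) ⁻¹' {t | ∃ z ∈ A, Along dL G (f x) t z}) ?_
        ((Measure.measurePreserving_sub_left volume σ).quasiMeasurePreserving.preimage_null
          (hx hxI))
      intro t ht
      obtain ⟨⟨z, hz, hs⟩, -⟩ := hWs ht
      exact ⟨z, hz, by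
        have := h.along_trans hfI hxI hσ (GeodesicRaySystem.along_of_seg' hs)
        rwa [← sub_eq_add_neg] at this⟩
    · refine measure_mono_null (t := ∅) (fun t ht => hxI (hWs ht).2) measure_empty
  have hswap : volume.prod μ
      {q : ℝ × X | q.2 ∈ displaced dL G A q.1 ∩ {x | Interior G x}} = 0 :=
    (Measure.measurePreserving_swap (μ := (volume : Measure ℝ))
      (ν := μ)).quasiMeasurePreserving.preimage_null hW0
  refine (ae_restrict_iff' measurableSet_Ioi).2 ?_
  filter_upwards [Measure.measure_ae_null_of_prod_null hswap] with t ht ht0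
  refine measure_mono_null (fun x hx => ?_)
    (measure_union_null ht (h.measure_nonIsolated_diff_interior hpos))
  by_cases hxI : Interior G x
  · exact Or.inl ⟨hx, hxI⟩
  · exact Or.inr ⟨Or.inl (exists_pred_of_mem_displaced ht0 hx), hxI⟩

end AnalyticRaySystem

end Displacement

open ProbabilityTheory

/-! ### Existence and uniqueness of disintegrations. -/

section Disintegration

variable {X : Type*} [MetricSpace X] [PolishSpace X] [MeasurableSpace X] [BorelSpace X]
  {μ : Measure X}

omit [MetricSpace X] [PolishSpace X] [BorelSpace X] in
/-- An a.e.-measurable map agrees on a conull Borel part of `T` with a Borel map. -/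
theorem exists_measurable_subset_eq_mk {T : Set X} (hT : NullMeasurableSet T μ) {f : X → X}
    (hf : AEMeasurable f (μ.restrict T)) :
    ∃ Z, MeasurableSet Z ∧ Z ⊆ T ∧ (∀ x ∈ Z, f x = hf.mk f x) ∧ μ.restrict T Zᶜ = 0 := by
  have hae : ∀ᵐ x ∂μ.restrict T, x ∈ T ∧ f x = hf.mk f x :=
    (ae_restrict_mem₀ hT).and hf.ae_eq_mk
  obtain ⟨N, hN, hNm, hN0⟩ := exists_measurable_superset_of_null (ae_iff.1 hae)
  have hZ : ∀ x ∈ Nᶜ, x ∈ T ∧ f x = hf.mk f x := fun x hx => by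
    by_contra hne
    exact hx (hN hne)
  exact ⟨Nᶜ, hNm.compl, fun x hx => (hZ x hx).1, fun x hx => (hZ x hx).2, by rwa [compl_compl]⟩

/-- The image measure is concentrated on the image. -/
theorem ae_mem_image [SFinite μ] {T : Set X} (hT : NullMeasurableSet T μ) {f : X → X}
    (hf : AEMeasurable f (μ.restrict T)) : ∀ᵐ y ∂(μ.restrict T).map f, y ∈ f '' T := by
  obtain ⟨Z, hZ, hZT, hZf, hZ0⟩ := exists_measurable_subset_eq_mk hT hf
  have han : AnalyticSet (hf.mk f '' Z) := hZ.analyticSet_image hf.measurable_mk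
  have hnull := han.nullMeasurableSet ((μ.restrict T).map f)
  refine measure_mono_null (t := (hf.mk f '' Z)ᶜ) (compl_subset_compl.2 ?_) ?_
  · rintro _ ⟨x, hx, rfl⟩
    exact ⟨x, hZT hx, hZf x hx⟩
  · rw [Measure.map_apply₀ hf hnull.compl]
    refine measure_mono_null (t := Zᶜ) (fun x hx hxZ => hx ?_) hZ0
    exact ⟨x, hxZ, (hZf x hxZ).symm⟩

/-- A strongly consistent disintegration over a measurable map. -/
theorem exists_disintegration [IsFiniteMeasure μ] [Nonempty X] {T : Set X}
    (hT : NullMeasurableSet T μ) {f : X → X} (hf : AEMeasurable f (μ.restrict T)) :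
    ∃ κ : X → Measure X,
      (∀ y ∈ f '' T, IsProbabilityMeasure (κ y)) ∧
      (∀ B, MeasurableSet B → AEMeasurable (fun y => κ y B) ((μ.restrict T).map f)) ∧
      (∀ B C, MeasurableSet B → MeasurableSet C →
        μ (T ∩ B ∩ f ⁻¹' C) = ∫⁻ y in C, κ y B ∂(μ.restrict T).map f) ∧
      ∀ y ∈ f '' T, κ y {x | x ∈ T ∧ f x = y}ᶜ = 0 := by
  classical
  obtain ⟨Z, hZ, hZT, hZf, hZ0⟩ := exists_measurable_subset_eq_mk hT hf
  set κ₀ : Kernel X X := condDistrib id f (μ.restrict T)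
  have hcomp : (μ.restrict T).map f ⊗ₘ κ₀ = (μ.restrict T).map fun x => (f x, x) :=
    compProd_map_condDistrib aemeasurable_id
  have hpair : AEMeasurable (fun x => (f x, x)) (μ.restrict T) := hf.prodMk aemeasurable_id
  have hgraph : MeasurableSet {p : X × X | p.2 ∈ Z ∧ hf.mk f p.2 = p.1} :=
    (measurable_snd hZ).inter (measurableSet_eq_fun (hf.measurable_mk.comp measurable_snd)
      measurable_fst)
  have hae : ∀ᵐ y ∂(μ.restrict T).map f, ∀ᵐ x ∂κ₀ y, x ∈ Z ∧ hf.mk f x = y := by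
    rw [← Measure.ae_compProd_iff hgraph, hcomp, ae_map_iff hpair hgraph]
    have : ∀ᵐ x ∂μ.restrict T, x ∈ Z := hZ0
    filter_upwards [this] with x hx
    exact ⟨hx, (hZf x hx).symm⟩
  have hgood : ∀ᵐ y ∂(μ.restrict T).map f, κ₀ y {x | x ∈ T ∧ f x = y}ᶜ = 0 := by
    filter_upwards [hae] with y hy
    refine ae_iff.1 (hy.mono fun x hx => ?_)
    exact ⟨hZT hx.1, (hZf x hx.1).trans hx.2⟩
  have hch : ∀ y, ∃ x, y ∈ f '' T → x ∈ T ∧ f x = y := fun y => by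
    by_cases hy : y ∈ f '' T
    · obtain ⟨x, hx⟩ := hy
      exact ⟨x, fun _ => hx⟩
    · exact ⟨y, fun h => (hy h).elim⟩
  choose s hs using hch
  -- On the null set of bad `y` a Dirac mass in the fibre replaces `κ₀ y`, so that concentration on
  -- the fibre holds for every `y` in the image.
  let κ : X → Measure X := fun y =>
    if κ₀ y {x | x ∈ T ∧ f x = y}ᶜ = 0 then κ₀ y else Measure.dirac (s y)
  have hκ : ∀ᵐ y ∂(μ.restrict T).map f, κ y = κ₀ y := by
    filter_upwards [hgood] with y hy
    exact if_pos hy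
  refine ⟨κ, fun y hy => ?_, fun B hB => ?_, fun B C hB hC => ?_, fun y hy => ?_⟩
  · by_cases h0 : κ₀ y {x | x ∈ T ∧ f x = y}ᶜ = 0
    · simp only [κ, if_pos h0]; infer_instance
    · simp only [κ, if_neg h0]; infer_instance
  · refine (κ₀.measurable_coe hB).aemeasurable.congr ?_
    filter_upwards [hκ] with y hy
    rw [hy]
  · have h1 : ∫⁻ y in C, κ y B ∂(μ.restrict T).map f = ∫⁻ y in C, κ₀ y B ∂(μ.restrict T).map f :=
      lintegral_congr_ae ((ae_restrict_of_ae hκ).mono fun y hy => by simp only [hy])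
    rw [h1, ← Measure.compProd_apply_prod hC hB, hcomp,
      Measure.map_apply_of_aemeasurable hpair (hC.prod hB),
      Measure.restrict_apply₀ (hpair.nullMeasurable (hC.prod hB))]
    congr 1
    ext x
    simp only [mem_inter_iff, mem_preimage, mem_prod]
    tauto
  · by_cases h0 : κ₀ y {x | x ∈ T ∧ f x = y}ᶜ = 0
    · simp only [κ, if_pos h0, h0]
    · simp only [κ, if_neg h0]
      rw [Measure.dirac_apply, indicator_of_notMem]
      exact fun hn => hn (hs y hy)

/-- Two families of finite measures that have the same integrals over all rectangles agree a.e. -/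
theorem ae_eq_of_forall_setLIntegral_apply_eq {m : Measure X} [IsFiniteMeasure m]
    {κ η : X → Measure X} (hfin : ∀ᵐ y ∂m, IsFiniteMeasure (κ y))
    (hκ : ∀ B, MeasurableSet B → AEMeasurable (fun y => κ y B) m)
    (hη : ∀ B, MeasurableSet B → AEMeasurable (fun y => η y B) m)
    (heq : ∀ B C, MeasurableSet B → MeasurableSet C →
      ∫⁻ y in C, κ y B ∂m = ∫⁻ y in C, η y B ∂m) : ∀ᵐ y ∂m, κ y = η y := by
  have hB : ∀ B, MeasurableSet B → ∀ᵐ y ∂m, κ y B = η y B := fun B hB =>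
    ae_eq_of_forall_setLIntegral_eq_of_sigmaFinite₀ (hκ B hB) (hη B hB)
      fun C hC _ => heq B C hB hC
  -- A countable generating algebra lets a single null set of `y` serve for all its members at once.
  set 𝒜 := generateSetAlgebra (MeasurableSpace.countableGeneratingSet X)
  have hgen : ‹MeasurableSpace X› = MeasurableSpace.generateFrom 𝒜 := by
    rw [generateFrom_generateSetAlgebra_eq, MeasurableSpace.generateFrom_countableGeneratingSet]
  have hmeas : ∀ s ∈ 𝒜, MeasurableSet s := fun s hs => by
    rw [hgen]
    exact MeasurableSpace.measurableSet_generateFrom hs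
  have hpi : IsPiSystem 𝒜 := fun s hs t ht _ => isSetAlgebra_generateSetAlgebra.inter_mem hs ht
  have hcount : 𝒜.Countable :=
    countable_generateSetAlgebra (MeasurableSpace.countable_countableGeneratingSet)
  have hall : ∀ᵐ y ∂m, ∀ s ∈ 𝒜, κ y s = η y s :=
    (ae_ball_iff hcount).2 fun s hs => hB s (hmeas s hs)
  filter_upwards [hall, hB univ MeasurableSet.univ, hfin] with y h1 h2 h3
  exact ext_of_generate_finite 𝒜 hgen hpi h1 h2

end Disintegration

/-! ### Density along rays and absolute continuity of the conditional probabilities. -/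

section AbsoluteContinuity

variable {X : Type*} [MetricSpace X] [PolishSpace X] [MeasurableSpace X] [BorelSpace X]
  {dL : ExtDist X} {G : X → X → Prop} {μ : Measure X}

namespace AnalyticRaySystem

variable (h : AnalyticRaySystem dL G)
include h

/-- Up to null sets, the ray map is a Borel map defined on a Borel set. -/
theorem exists_measurable_rayMap (ν : Measure (X × ℝ)) [SFinite ν] :
    ∃ (D : Set (X × ℝ)) (g : X × ℝ → X), MeasurableSet D ∧ Measurable g ∧
      ∀ᵐ q ∂ν, Interior G q.1 → (q ∈ D ↔ ∃ x, Interior G x ∧ Along dL G q.1 q.2 x) ∧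
        (q ∈ D → Interior G (g q) ∧ Along dL G q.1 q.2 (g q)) := by
  classical
  have han : ∀ B, MeasurableSet B → AnalyticSet
      {q : X × ℝ | Interior G q.1 ∧ ∃ x, Interior G x ∧ x ∈ B ∧ Along dL G q.1 q.2 x} := by
    intro B hB
    have h1 : AnalyticSet {p : (X × ℝ) × X |
        Interior G p.2 ∧ p.2 ∈ B ∧ Along dL G p.1.1 p.1.2 p.2} :=
      (h.analyticSet_along_interior hB).preimage
        (f := fun p : (X × ℝ) × X => (p.1.1, p.1.2, p.2)) (by fun_prop)
    exact (h.analyticSet_interior.preimage continuous_fst).inter' h1.exists_snd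
  set D₀ : Set (X × ℝ) :=
    {q | Interior G q.1 ∧ ∃ x, Interior G x ∧ x ∈ univ ∧ Along dL G q.1 q.2 x}
  have hD₀ := (han univ MeasurableSet.univ).nullMeasurableSet ν
  -- The default value `q.1` off `D₀` makes the preimage of a Borel set split into an analytic part
  -- and a part cut from the complement of `D₀` by a Borel set.
  have hch : ∀ q : X × ℝ, ∃ x, (q ∈ D₀ → Interior G x ∧ Along dL G q.1 q.2 x) ∧
      (q ∉ D₀ → x = q.1) := by
    intro q
    by_cases hq : q ∈ D₀
    · obtain ⟨-, x, hx, -, hxA⟩ := id hq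
      exact ⟨x, fun _ => ⟨hx, hxA⟩, fun hn => (hn hq).elim⟩
    · exact ⟨q.1, fun hn => (hq hn).elim, fun _ => rfl⟩
  choose g₀ hg₁ hg₂ using hch
  have hg₀ : AEMeasurable g₀ ν := by
    refine NullMeasurable.aemeasurable fun B hB => ?_
    have : g₀ ⁻¹' B =
        {q : X × ℝ | Interior G q.1 ∧ ∃ x, Interior G x ∧ x ∈ B ∧ Along dL G q.1 q.2 x} ∪
          (D₀ᶜ ∩ Prod.fst ⁻¹' B) := by
      ext q
      by_cases hq : q ∈ D₀
      · obtain ⟨h1, h2⟩ := hg₁ q hq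
        simp only [mem_preimage, mem_union, mem_ofPred_eq, mem_inter_iff, mem_compl_iff, hq,
          not_true, false_and, or_false]
        constructor
        · exact fun hB => ⟨hq.1, g₀ q, h1, hB, h2⟩
        · rintro ⟨hI, x, hx, hxB, hxA⟩
          rwa [h.eq_of_along hI h2 hxA]
      · have hn : q ∉ {q : X × ℝ | Interior G q.1 ∧
            ∃ x, Interior G x ∧ x ∈ B ∧ Along dL G q.1 q.2 x} :=
          fun ⟨hI, x, hx, _, hxA⟩ => hq ⟨hI, x, hx, mem_univ _, hxA⟩
        rw [mem_union, or_iff_right hn, mem_preimage, hg₂ q hq]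
        exact ⟨fun hB => ⟨hq, hB⟩, fun hB => hB.2⟩
    rw [this]
    exact ((han B hB).nullMeasurableSet ν).union
      (hD₀.compl.inter (measurable_fst hB).nullMeasurableSet)
  obtain ⟨D, -, hD, hDe⟩ := hD₀.exists_measurable_superset_ae_eq
  refine ⟨D, hg₀.mk g₀, hD, hg₀.measurable_mk, ?_⟩
  filter_upwards [hDe.mem_iff, hg₀.ae_eq_mk] with q hqD hqg hI
  rw [← hqg, hqD]
  refine ⟨⟨fun ⟨_, x, hx, _, hxA⟩ => ⟨x, hx, hxA⟩, fun ⟨x, hx, hxA⟩ => ⟨hI, x, hx, trivial, hxA⟩⟩,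
    hg₁ q⟩

/-- The restriction of `μ` to the interior points of the rays has a density with respect to the
superposition of the Lebesgue measures of the rays, and its conditional probabilities are
absolutely continuous. -/
theorem ae_absolutelyContinuous [IsFiniteMeasure μ]
    (hpos : DisplacementPositive dL G μ {x | NonIsolated G x}) {f : X → X}
    (hf : ∀ x, Interior G x → Interior G (f x) ∧ (G x (f x) ∨ G (f x) x))
    (hfeq : ∀ x, Interior G x → ∀ y, Interior G y → (G x y ∨ G y x) → f x = f y)
    (hfm : AEMeasurable f (μ.restrict {x | Interior G x})) {κ : X → Measure X}
    (hprob : ∀ y ∈ f '' {x | Interior G x}, IsProbabilityMeasure (κ y))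
    (hκ : ∀ B, MeasurableSet B →
      AEMeasurable (fun y => κ y B) ((μ.restrict {x | Interior G x}).map f))
    (hcons : ∀ B C, MeasurableSet B → MeasurableSet C → μ ({x | Interior G x} ∩ B ∩ f ⁻¹' C) =
      ∫⁻ y in C, κ y B ∂(μ.restrict {x | Interior G x}).map f) :
    ∀ᵐ y ∂(μ.restrict {x | Interior G x}).map f, ∀ N, MeasurableSet N →
      volume {t : ℝ | ∃ x ∈ N, Along dL G y t x} = 0 → κ y N = 0 := by
  classical
  set T : Set X := {x | Interior G x}
  have hT : NullMeasurableSet T μ := h.analyticSet_interior.nullMeasurableSet μ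
  set m : Measure X := (μ.restrict T).map f
  have hmim : ∀ᵐ y ∂m, y ∈ f '' T := ae_mem_image hT hfm
  have hfT : ∀ y ∈ f '' T, Interior G y := by
    rintro _ ⟨x, hx, rfl⟩
    exact (hf x hx).1
  have hfx : ∀ y ∈ f '' T, f y = y := by
    rintro _ ⟨x, hx, rfl⟩
    exact (hfeq x hx _ (hf x hx).1 (hf x hx).2).symm
  -- A finite measure equivalent to Lebesgue keeps the image `lam` finite; the image of a σ-finite
  -- measure need not be σ-finite, and Radon–Nikodym would be unavailable.
  let ρ : Measure ℝ := (volume : Measure ℝ).toFinite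
  have hρ : ρ ≪ volume := toFinite_absolutelyContinuous _
  have hρ' : volume ≪ ρ := absolutelyContinuous_toFinite _
  obtain ⟨D, g, hD, hg, hDg⟩ := h.exists_measurable_rayMap (m.prod ρ)
  have hsec : ∀ᵐ y ∂m, ∀ᵐ t ∂ρ, ((y, t) ∈ D ↔ ∃ x, Interior G x ∧ Along dL G y t x) ∧
      ((y, t) ∈ D → Interior G (g (y, t)) ∧ Along dL G y t (g (y, t))) := by
    filter_upwards [Measure.ae_ae_of_ae_prod hDg, hmim] with y hy hyT
    filter_upwards [hy] with t ht using ht (hfT y hyT)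
  let lam : Measure X := ((m.prod ρ).restrict D).map g
  -- A `lam`-null set meets `m`-almost every ray in a Lebesgue-null set of parameters, so the
  -- displacement argument applies.
  have hac : μ.restrict T ≪ lam := by
    refine Measure.AbsolutelyContinuous.mk fun A hA hA0 => ?_
    rw [Measure.map_apply hg hA, Measure.restrict_apply (hg hA),
      Measure.measure_prod_null ((hg hA).inter hD)] at hA0
    rw [Measure.restrict_apply hA]
    obtain ⟨A', hA's, hA'm, hA'e⟩ :=
      (hA.nullMeasurableSet.inter hT).exists_measurable_subset_ae_eq
    rw [← measure_congr hA'e]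
    refine h.measure_eq_zero_of_ae_ray hpos hf hfm hA'm (fun x hx => (hA's hx).2) ?_
    filter_upwards [hA0, hsec, hmim] with y hy0 hys hyT
    refine hρ' (measure_mono_null (t := (Prod.mk y ⁻¹' (g ⁻¹' A ∩ D)) ∪
      {t | ¬ (((y, t) ∈ D ↔ ∃ x, Interior G x ∧ Along dL G y t x) ∧
      ((y, t) ∈ D → Interior G (g (y, t)) ∧ Along dL G y t (g (y, t))))}) ?_
      (measure_union_null hy0 (ae_iff.1 hys)))
    rintro t ⟨x, hx, hxt⟩
    by_cases hgood : ((y, t) ∈ D ↔ ∃ x, Interior G x ∧ Along dL G y t x) ∧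
      ((y, t) ∈ D → Interior G (g (y, t)) ∧ Along dL G y t (g (y, t)))
    · have hmem : (y, t) ∈ D := hgood.1.2 ⟨x, (hA's hx).2, hxt⟩
      refine Or.inl ⟨?_, hmem⟩
      rw [mem_preimage, h.eq_of_along (hfT y hyT) (hgood.2 hmem).2 hxt]
      exact (hA's hx).1
    · exact Or.inr hgood
  let d : X → ℝ≥0∞ := (μ.restrict T).rnDeriv lam
  have hd : Measurable d := Measure.measurable_rnDeriv _ _
  have hdens : lam.withDensity d = μ.restrict T := Measure.withDensity_rnDeriv_eq _ _ hac
  -- Slicing the density along each ray gives a competing family, absolutely continuous by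
  -- construction, with which `κ` is shown to agree almost everywhere.
  let η : X → Measure X := fun y =>
    ((ρ.restrict (Prod.mk y ⁻¹' D)).map fun t => g (y, t)).withDensity d
  have hηapply : ∀ y B, MeasurableSet B →
      η y B = ∫⁻ t, D.indicator (fun q => B.indicator d (g q)) (y, t) ∂ρ := by
    intro y B hB
    have hgy : Measurable fun t => g (y, t) := hg.comp measurable_prodMk_left
    rw [withDensity_apply _ hB, ← lintegral_indicator hB,
      lintegral_map (hd.indicator hB) hgy, ← lintegral_indicator (measurable_prodMk_left hD)]
    rfl
  have hηm : ∀ B, MeasurableSet B → Measurable fun y => η y B := by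
    intro B hB
    simp only [hηapply _ B hB]
    exact (((hd.indicator hB).comp hg).indicator hD).lintegral_prod_right'
  obtain ⟨Z, hZ, hZT, hZf, hZ0⟩ := exists_measurable_subset_eq_mk hT hfm
  -- `f` is known to equal its Borel version only on `Z`; off `Z` the density vanishes, so the
  -- discrepancy is harmless.
  have hdZ : ∀ᵐ x ∂lam, x ∈ Zᶜ → d x = 0 := by
    refine (ae_restrict_iff' hZ.compl).1 ((lintegral_eq_zero_iff hd).1 ?_)
    rw [← withDensity_apply _ hZ.compl, hdens, hZ0]
  have hdg : ∀ᵐ q ∂m.prod ρ, q ∈ D → g q ∈ Zᶜ → d (g q) = 0 :=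
    (ae_restrict_iff' hD).1 (ae_of_ae_map hg.aemeasurable hdZ)
  -- Where the density is nonzero, the Borel version of `f` maps `g (y, t)` back to `y`, so
  -- restricting to the preimage of `C` amounts to testing `y ∈ C`.
  have hkey : ∀ C, ∀ᵐ y ∂m, ∀ᵐ t ∂ρ, ∀ B : Set X,
      D.indicator (fun q => (B ∩ hfm.mk f ⁻¹' C).indicator d (g q)) (y, t) =
        C.indicator (fun _ => D.indicator (fun q => B.indicator d (g q)) (y, t)) y := by
    intro C
    filter_upwards [Measure.ae_ae_of_ae_prod hdg, hsec, hmim] with y hy hys hyT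
    filter_upwards [hy, hys] with t ht hts B
    by_cases hq : (y, t) ∈ D
    · simp only [indicator_of_mem hq]
      by_cases hZg : g (y, t) ∈ Z
      · have hfg : hfm.mk f (g (y, t)) = y := by
          rw [← hZf _ hZg, ← hfeq y (hfT y hyT) _ (hts.2 hq).1
            (GeodesicRaySystem.rel_of_along (hts.2 hq).2), hfx y hyT]
        by_cases hyC : y ∈ C <;> by_cases hB : g (y, t) ∈ B <;>
          simp [indicator, hyC, hB, hfg]
      · have h0 := ht hq hZg
        simp [indicator, h0]
    · simp [indicator, hq]
  have heq : ∀ B C, MeasurableSet B → MeasurableSet C →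
      ∫⁻ y in C, κ y B ∂m = ∫⁻ y in C, η y B ∂m := by
    intro B C hB hC
    have hE : MeasurableSet (B ∩ hfm.mk f ⁻¹' C) := hB.inter (hfm.measurable_mk hC)
    rw [← hcons B C hB hC]
    have h1 : μ (T ∩ B ∩ f ⁻¹' C) = μ.restrict T (B ∩ hfm.mk f ⁻¹' C) := by
      have : (B ∩ f ⁻¹' C : Set X) =ᵐ[μ.restrict T] (B ∩ hfm.mk f ⁻¹' C : Set X) := by
        refine Filter.EventuallyEq.inter (Filter.EventuallyEq.refl _ _) ?_
        exact hfm.ae_eq_mk.preimage C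
      rw [← measure_congr this,
        Measure.restrict_apply₀ (hB.nullMeasurableSet.inter (hfm.nullMeasurable hC))]
      congr 1
      ext x
      simp only [mem_inter_iff]
      tauto
    have h2 : μ.restrict T (B ∩ hfm.mk f ⁻¹' C) = lam.withDensity d (B ∩ hfm.mk f ⁻¹' C) :=
      congrArg (fun ν : Measure X => ν (B ∩ hfm.mk f ⁻¹' C)) hdens.symm
    rw [h1, h2, withDensity_apply _ hE, ← lintegral_indicator hE,
      lintegral_map (hd.indicator hE) hg, ← lintegral_indicator hD,
      lintegral_prod _ (Measurable.indicator (f := fun q =>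
        (B ∩ hfm.mk f ⁻¹' C).indicator d (g q)) ((hd.indicator hE).comp hg) hD).aemeasurable,
      ← lintegral_indicator hC]
    refine lintegral_congr_ae ?_
    filter_upwards [hkey C] with y hy
    have : C.indicator (fun y => η y B) y =
        ∫⁻ t, C.indicator (fun _ => D.indicator (fun q => B.indicator d (g q)) (y, t)) y ∂ρ := by
      by_cases hyC : y ∈ C
      · simp only [indicator_of_mem hyC, hηapply y B hB]
      · simp only [indicator_of_notMem hyC, lintegral_zero]
    rw [this]
    exact lintegral_congr_ae (hy.mono fun t ht => ht B)
  have hfin : ∀ᵐ y ∂m, IsFiniteMeasure (κ y) := by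
    filter_upwards [hmim] with y hy
    have := hprob y hy
    infer_instance
  filter_upwards [ae_eq_of_forall_setLIntegral_apply_eq hfin hκ
    (fun B hB => (hηm B hB).aemeasurable) heq, hsec] with y hy hys N hN hN0
  rw [hy, hηapply y N hN]
  refine (lintegral_congr_ae ?_).trans lintegral_zero
  filter_upwards [hys, measure_eq_zero_iff_ae_notMem.1 (hρ hN0)] with t ht htN
  by_cases hq : (y, t) ∈ D
  · rw [indicator_of_mem hq]
    exact indicator_of_notMem (fun hgN => htN ⟨_, hgN, (ht.2 hq).2⟩) _
  · exact indicator_of_notMem hq _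

end AnalyticRaySystem

end AbsoluteContinuity

/-! ### Comparison of `ℋ¹` on a ray with Lebesgue measure. -/

section Hausdorff

variable {X : Type*} {dL : ExtDist X} {G : X → X → Prop}

/-- The set of parameters at which a ray visits a set is negligible as soon as the part of the ray
in this set is `ℋ¹`-negligible. -/
theorem GeodesicRaySystem.volume_eq_zero_of_hausdorffOne (h : GeodesicRaySystem dL G) {y : X}
    (hy : Interior G y) {N : Set X}
    (hN : hausdorffOne dL (N ∩ {x | G y x ∨ G x y}) = 0) :
    volume {t : ℝ | ∃ x ∈ N, Along dL G y t x} = 0 := by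
  let : EMetricSpace X := dL.toEMetricSpace
  set S : Set ℝ := {t : ℝ | ∃ x ∈ N, Along dL G y t x}
  -- The map from parameters to visited points is an isometry into `(X, d_L)`. Intrinsic Hausdorff
  -- outer measure on `S` thus agrees both with that of the image in `X` and with that of `S` in
  -- `ℝ`.
  choose φ hφN hφ using fun t : S => t.2
  have hiso : Isometry φ := by
    intro s t
    change dL.dist (φ s) (φ t) = edist (s : ℝ) t
    rw [edist_dist, Real.dist_eq]
    rcases le_total (s : ℝ) t with hst | hst
    · rw [(h.seg_of_along_along hy (hφ s) (hφ t) hst).2.2, abs_sub_comm,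
        abs_of_nonneg (sub_nonneg.2 hst)]
    · rw [dL.symm, (h.seg_of_along_along hy (hφ t) (hφ s) hst).2.2,
        abs_of_nonneg (sub_nonneg.2 hst)]
  have hmono : Monotone fun r : ℝ≥0∞ => r := monotone_id
  have h1 := OuterMeasure.isometry_comap_mkMetric (fun r => r) hiso (Or.inl hmono)
  have h2 := OuterMeasure.isometry_comap_mkMetric (fun r => r)
    (isometry_subtype_coe (s := S)) (Or.inl hmono)
  have h3 : (OuterMeasure.mkMetric fun r => r : OuterMeasure S) univ = 0 := by
    rw [← h1, OuterMeasure.comap_apply]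
    refine le_antisymm ((measure_mono ?_).trans hN.le) zero_le
    rintro _ ⟨t, -, rfl⟩
    exact ⟨hφN t, rel_of_along (hφ t)⟩
  rw [← h2, OuterMeasure.comap_apply, image_univ, Subtype.range_coe] at h3
  have hvol : (volume : Measure ℝ) = Measure.mkMetric fun r => r := by
    rw [← hausdorffMeasure_real, Measure.hausdorffMeasure]
    simp
  rw [hvol, ← Measure.coe_toOuterMeasure, Measure.mkMetric_toOuterMeasure]
  exact h3

end Hausdorff

/-! ### Translation to the ray map and the evolution of sets. -/

section Assembly

variable {X : Type*} [MetricSpace X] [PolishSpace X] [MeasurableSpace X] [BorelSpace X]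
  {dL : ExtDist X} {Γ : Set (X × X)} {μ : Measure X}

theorem orientedRays_analyticRaySystem (hdL : IsGeodesicSetting dL)
    (hmon : CyclicallyMonotone dL Γ) (hfin : ∀ p ∈ Γ, dL.dist p.1 p.2 < ∞)
    (hΓ : MeasurableSet Γ) : AnalyticRaySystem dL fun x y => (x, y) ∈ orientedRays dL Γ :=
  ⟨orientedRays_geodesicRaySystem hdL hmon hfin, hdL.borel,
    analyticSet_orientedRays hdL.borel hΓ, hdL.continuous, hdL.locallyCompact⟩

omit [MetricSpace X] [PolishSpace X] [MeasurableSpace X] [BorelSpace X] in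
theorem rayMap_iff {f : X → X} {y x : X} {t : ℝ} : rayMap dL Γ f y t x ↔
    y ∈ f '' transportSet dL Γ ∧ Along dL (fun x y => (x, y) ∈ orientedRays dL Γ) y t x := by
  unfold rayMap Along Seg
  refine and_congr_right fun _ => or_congr ?_ ?_
  · rw [dL.symm x y]; tauto
  · constructor
    · exact fun ⟨h1, h2, h3⟩ => ⟨h1, by linarith, h2, h3⟩
    · exact fun ⟨h1, _, h2, h3⟩ => ⟨h1, h2, h3⟩

-- For `t > 0` the evolution `A_t` is contained in the displacement of `A`: parameters `s` and `s +
-- t` on one ray differ by a forward move of length `t`, whatever the base point.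
omit [MetricSpace X] [PolishSpace X] [BorelSpace X] in
theorem EvolutionPositive.displacementPositive
    (h : GeodesicRaySystem dL fun x y => (x, y) ∈ orientedRays dL Γ) {f : X → X}
    (hf : IsCrossSection dL Γ μ f) {E : Set X} (hE : EvolutionPositive dL Γ μ f E) :
    DisplacementPositive dL (fun x y => (x, y) ∈ orientedRays dL Γ) μ E := by
  intro A hA hAE h0
  by_contra hne
  have hpos := hE A hA hAE (pos_iff_ne_zero.2 hne)
  refine hpos.ne' ((lintegral_congr_ae ?_).trans lintegral_zero)
  filter_upwards [h0, ae_restrict_mem measurableSet_Ioi] with t ht ht0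
  refine measure_mono_null ?_ ht
  rintro x' ⟨y, s, ⟨x, hx, hs⟩, hst⟩
  obtain ⟨⟨z, hz, rfl⟩, hs⟩ := rayMap_iff.1 hs
  refine ⟨x, hx, ?_⟩
  have := h.seg_of_along_along (hf.mapsTo z hz) hs (rayMap_iff.1 hst).2
    (le_add_of_nonneg_right (le_of_lt ht0))
  rwa [add_sub_cancel_left] at this

end Assembly

end MongeRays

open MongeRays in
theorem mainTheorem2 {X : Type*} [MetricSpace X] [PolishSpace X] [MeasurableSpace X]
    [BorelSpace X] (dL : MongeRays.ExtDist X) (hdL : MongeRays.IsGeodesicSetting dL)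
    (μ ν : Measure X) [IsProbabilityMeasure μ] [IsProbabilityMeasure ν]
    (π : Measure (X × X)) [IsProbabilityMeasure π] (Γ : Set (X × X))
    (hπ : MongeRays.IsMonotonePlan dL μ ν π Γ) :
    (∃ f : X → X, MongeRays.IsCrossSection dL Γ μ f) ∧
    ∀ f : X → X, MongeRays.IsCrossSection dL Γ μ f →
      MongeRays.EvolutionPositive dL Γ μ f (MongeRays.transportSetE dL Γ) →
      μ (MongeRays.transportSetE dL Γ \ MongeRays.transportSet dL Γ) = 0 ∧
      (MongeRays.EvolutionPositive dL Γ μ f univ → μ (MongeRays.transportSet dL Γ)ᶜ = 0) ∧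
      (∃ κ : X → Measure X, MongeRays.IsRayDisintegration dL Γ μ f κ) ∧
      ∀ κ : X → Measure X, MongeRays.IsRayDisintegration dL Γ μ f κ →
        ∀ᵐ y ∂(MongeRays.quotientMeasure dL Γ μ f), ∀ N : Set X, MeasurableSet N →
          (MongeRays.hausdorffOne dL (N ∩ MongeRays.ray dL Γ y) = 0 → κ y N = 0) ∧
          (volume {t : ℝ | ∃ x ∈ N, MongeRays.rayMap dL Γ f y t x} = 0 → κ y N = 0) := by
  have : Nonempty X := nonempty_of_isProbabilityMeasure μ
  have h := orientedRays_analyticRaySystem hdL hπ.monotone hπ.finite_on hπ.measurableSet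
  have hT : NullMeasurableSet (transportSet dL Γ) μ := h.analyticSet_interior.nullMeasurableSet μ
  refine ⟨?_, fun f hf hE => ?_⟩
  · obtain ⟨f, h1, h2, h3⟩ := h.exists_crossSection μ
    exact ⟨f, fun x hx => (h1 x hx).1, fun x hx => (h1 x hx).2, h2, h3.restrict⟩
  have hpos := hE.displacementPositive h.toGeodesicRaySystem hf
  refine ⟨h.measure_nonIsolated_diff_interior hpos, fun hU =>
    h.measure_compl_interior (hU.displacementPositive h.toGeodesicRaySystem hf), ?_,
    fun κ hκ => ?_⟩
  · obtain ⟨κ, h1, h2, h3, h4⟩ := exists_disintegration hT hf.aemeasurable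
    exact ⟨κ, h1, h2, h3, h4⟩
  · filter_upwards [h.ae_absolutelyContinuous hpos (fun x hx => ⟨hf.mapsTo x hx, hf.mem_ray x hx⟩)
      hf.eq_of_mem_ray hf.aemeasurable hκ.prob hκ.aemeasurable hκ.consistent,
      ae_mem_image hT hf.aemeasurable] with y hy hyT N hN
    have hyI : Interior (fun x y => (x, y) ∈ orientedRays dL Γ) y := by
      obtain ⟨x, hx, rfl⟩ := hyT
      exact hf.mapsTo x hx
    refine ⟨fun h0 => hy N hN (h.volume_eq_zero_of_hausdorffOne hyI h0), fun h0 => hy N hN ?_⟩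
    refine measure_mono_null ?_ h0
    rintro t ⟨x, hx, hxt⟩
    exact ⟨x, hx, rayMap_iff.2 ⟨hyT, hxt⟩⟩
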